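/- Let $m,n\ge 3$ and consider the honeycomb lattice on the $m\times n$ torus: its hexagons are labelled by $p\in\mathbb Z_m\times\mathbb Z_n$, and the hexagon $p$ is adjacent to $p\pm(1,0)$, $p\pm(0,1)$, $p\pm(1,-1)$. The lattice is bipartite with vertex classes $A$ and $B$, and every edge carries a variable in $\mathbb Z_3=\{0,1,2\}$, where $1$ denotes an arrow from $A$ to $B$, $2$ an arrow from $B$ to $A$, and $0$ no arrow. The Hilbert space has the edge configurations $|L\rangle$ as orthonormal basis. A configuration is allowed at a vertex if the three edge variables there sum to $0$ modulo $3$ and are not all $0$; it is valid ($L\in\mathcal L$) if it is allowed at every vertex. Let $N_{\mathrm{fold}}(L)$ be the number of $A$-vertices with pattern $222$ plus the number of $B$-vertices with pattern $111$ (folded trimers), and let $N_h(L),N_v(L)\in\mathbb Z_3$ be the sums of the edge variables crossed by the horizontal loop through the hexagons $(i,0)$, $i\in\mathbb Z_m$, and by the vertical loop through the hexagons $(0,j)$, $j\in\mathbb Z_n$. Fix a weight $\zeta\in\mathbb C\setminus\{0\}$ (the equal-weight case is $\zeta=1$), put $\omega=e^{2\pi i/3}$, and for $\nu_h,\nu_v\in\mathbb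 Z_3$ let $$|\Psi_{\nu_h,\nu_v}\rangle=\sum_{L\in\mathcal L}\omega^{\nu_hN_h(L)+\nu_vN_v(L)}\,\zeta^{N_{\mathrm{fold}}(L)}\,|L\rangle ,$$ so that $|\Psi_{0,0}\rangle$ is the trimer state. For each vertex let $h_{\mathrm{vertex}}$ be the orthogonal projector, acting on the three edges at the vertex, whose kernel is spanned by the allowed configurations of these edges. For each pair of adjacent hexagons let $h_{\mathrm{two\text{-}hexagon}}$ be the orthogonal projector, acting on the edges of the two hexagons, whose kernel is spanned by the states $\sum_x \zeta^{N_{\mathrm{fold}}(x,\sigma)}|x\rangle$, one for each configuration $\sigma$ of the surrounding edges, where $x$ runs over the configurations of the edges of the two hexagons that together with $\sigma$ are allowed at every vertex touching the two hexagons, and $N_{\mathrm{fold}}(x,\sigma)$ counts the folded trimers at these vertices. Let $$H=\sum h_{\mathrm{vertex}}+\sum h_{\mathrm{two\text{-}hexagon}},$$ summed over all vertices and over all pairs of adjacent hexagons. Then: 1. Each vertex term acts on $3$ edges and each two-hexagon term on $11$ edges. 2. All terms, and hence $H$, are positive semidefinite, the smallest eigenvalue of $H$ is $0$, and $H$ is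 frustration-free: every ground state is annihilated by every single term. 3. The ground space of $H$ has dimension exactly $9$ and is spanned by the nine states $|\Psi_{\nu_h,\nu_v}\rangle$, $\nu_h,\nu_v\in\mathbb Z_3$. 4. Two valid configurations $L,L'$ can be connected by a finite sequence of two-hexagon moves (each replacing a valid configuration by a valid configuration that differs from it only on the edges of two adjacent hexagons) if and only if $N_h(L)=N_h(L')$ and $N_v(L)=N_v(L')$. -/

import Mathlib

noncomputable section

namespace TrimerModel

/-- Sites of the triangular lattice on the `m × n` torus. They label the hexagons (plaquettes) of
the dual honeycomb lattice; the six neighbours of `p` are `p ± (1,0)`, `p ± (0,1)`,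
`p ± (1,-1)`. -/
abbrev Site (m n : ℕ) : Type := ZMod m × ZMod n

/-- Vertices of the honeycomb lattice: `Sum.inl p` is the `A`-vertex where the hexagons
`p`, `p + (1,0)`, `p + (0,1)` meet, `Sum.inr p` is the `B`-vertex where the hexagons
`p + (1,1)`, `p + (1,0)`, `p + (0,1)` meet. -/
abbrev Vertex (m n : ℕ) : Type := Site m n ⊕ Site m n

/-- Edges (links) of the honeycomb lattice, labelled by their `A`-endpoint `p` and one of three
directions: `(p, 0)` separates the hexagons `p + (1,0)` and `p + (0,1)`, `(p, 1)` separates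
`p` and `p + (0,1)`, and `(p, 2)` separates `p` and `p + (1,0)`. -/
abbrev Edge (m n : ℕ) : Type := Site m n × Fin 3

/-- Link configurations: a `ℤ/3` variable on every edge. The value `1` is an arrow from the `A`- to
the `B`-endpoint, the value `2` an arrow from `B` to `A`, and `0` is "no arrow". -/
abbrev Config (m n : ℕ) : Type := Edge m n → ZMod 3

/-- Link configurations on a set `R` of edges. -/
abbrev LocalConfig {m n : ℕ} (R : Finset (Edge m n)) : Type := R → ZMod 3

/-- The Hilbert space of the model, with orthonormal basis the link configurations. -/
abbrev HilbertSpace (m n : ℕ) [NeZero m] [NeZero n] : Type := EuclideanSpace ℂ (Config m n)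

/-- The Hilbert space of the edges in `R`. -/
abbrev LocalSpace {m n : ℕ} (R : Finset (Edge m n)) : Type := EuclideanSpace ℂ (LocalConfig R)

/-- The three edges at a vertex. -/
def vertexStar {m n : ℕ} : Vertex m n → Finset (Edge m n)
  | Sum.inl p => {(p, 0), (p, 1), (p, 2)}
  | Sum.inr p => {(p, 0), (p + (1, 0), 1), (p + (0, 1), 2)}

/-- The edges around the hexagon `p`. -/
def hexagon {m n : ℕ} (p : Site m n) : Finset (Edge m n) :=
  {(p, 1), (p, 2), (p - (1, 0), 0), (p - (1, 0), 2), (p - (0, 1), 0), (p - (0, 1), 1)}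

/-- The three directions that reach each unordered pair of adjacent hexagons exactly once. -/
def direction {m n : ℕ} : Fin 3 → Site m n := ![(1, 0), (0, 1), (-1, 1)]

/-- The edges around one or both of the two adjacent hexagons `p` and `p + direction d`. -/
def twoHexagon {m n : ℕ} (p : Site m n) (d : Fin 3) : Finset (Edge m n) :=
  hexagon p ∪ hexagon (p + direction d)

/-- The configuration at the vertex `v` is allowed: it obeys the `ℤ/3` Gauss law and is
not `000`. -/
def AllowedAt {m n : ℕ} (v : Vertex m n) (c : Config m n) : Prop :=
  ∑ e ∈ vertexStar v, c e = 0 ∧ ∃ e ∈ vertexStar v, c e ≠ 0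

/-- The valid configurations: those that are allowed at every vertex. -/
def Valid {m n : ℕ} (c : Config m n) : Prop := ∀ v : Vertex m n, AllowedAt v c

/-- There is a folded trimer at the vertex `v`: the pattern is `222` around an `A`-vertex, or `111`
around a `B`-vertex. -/
def FoldedAt {m n : ℕ} : Vertex m n → Config m n → Prop
  | Sum.inl p, c => ∀ e ∈ vertexStar (Sum.inl p), c e = 2
  | Sum.inr p, c => ∀ e ∈ vertexStar (Sum.inr p), c e = 1

open Classical in
/-- The total number of folded trimers. -/
def foldedCount {m n : ℕ} [NeZero m] [NeZero n] (c : Config m n) : ℕ :=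
  (Finset.univ.filter fun v : Vertex m n => FoldedAt v c).card

/-- The sum of the link variables crossed by the horizontal loop through the hexagons `(i, 0)`. -/
def windingH {m n : ℕ} [NeZero m] (c : Config m n) : ZMod 3 := ∑ i : ZMod m, c ((i, 0), 2)

/-- The sum of the link variables crossed by the vertical loop through the hexagons `(0, j)`. -/
def windingV {m n : ℕ} [NeZero n] (c : Config m n) : ZMod 3 := ∑ j : ZMod n, c ((0, j), 1)

theorem sum_vertexStar_inl {m n : ℕ} (p : Site m n) (c : Config m n) :
    ∑ e ∈ vertexStar (Sum.inl p), c e = c (p, 0) + c (p, 1) + c (p, 2) := by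
  simp [vertexStar, add_assoc]

theorem sum_vertexStar_inr {m n : ℕ} (p : Site m n) (c : Config m n) :
    ∑ e ∈ vertexStar (Sum.inr p), c e = c (p, 0) + c (p + (1, 0), 1) + c (p + (0, 1), 2) := by
  simp [vertexStar, add_assoc]

/-- By the Gauss law any horizontal loop gives the same sum, so `windingH` is well defined. -/
theorem windingH_eq_succ {m n : ℕ} [NeZero m] (c : Config m n)
    (hc : Valid c) (j : ZMod n) :
    ∑ i : ZMod m, c ((i, j + 1), 2) = ∑ i : ZMod m, c ((i, j), 2) := by
  have hA : ∑ i : ZMod m, (c ((i, j), 0) + c ((i, j), 1) + c ((i, j), 2)) = 0 :=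
    Finset.sum_eq_zero fun i _ => by rw [← sum_vertexStar_inl]; exact (hc _).1
  have hB : ∑ i : ZMod m, (c ((i, j), 0) + c ((i + 1, j), 1) + c ((i, j + 1), 2)) = 0 :=
    Finset.sum_eq_zero fun i _ => by
      have := (hc (Sum.inr (i, j))).1
      rw [sum_vertexStar_inr] at this
      simpa using this
  have hs : ∑ i : ZMod m, c ((i + 1, j), 1) = ∑ i : ZMod m, c ((i, j), 1) :=
    Equiv.sum_comp (Equiv.addRight (1 : ZMod m)) fun i => c ((i, j), 1)
  simp only [Finset.sum_add_distrib] at hA hB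
  rw [hs] at hB
  exact add_left_cancel (hB.trans hA.symm)

/-- By the Gauss law any vertical loop gives the same sum, so `windingV` is well defined. -/
theorem windingV_eq_succ {m n : ℕ} [NeZero n] (c : Config m n)
    (hc : Valid c) (i : ZMod m) :
    ∑ j : ZMod n, c ((i + 1, j), 1) = ∑ j : ZMod n, c ((i, j), 1) := by
  have hA : ∑ j : ZMod n, (c ((i, j), 0) + c ((i, j), 2) + c ((i, j), 1)) = 0 :=
    Finset.sum_eq_zero fun j _ => by
      have := (hc (Sum.inl (i, j))).1
      rw [sum_vertexStar_inl] at this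
      rw [← this]; ring
  have hB : ∑ j : ZMod n, (c ((i, j), 0) + c ((i, j + 1), 2) + c ((i + 1, j), 1)) = 0 :=
    Finset.sum_eq_zero fun j _ => by
      have := (hc (Sum.inr (i, j))).1
      rw [sum_vertexStar_inr] at this
      simp only [Prod.mk_add_mk, add_zero] at this
      rw [← this]; ring
  have hs : ∑ j : ZMod n, c ((i, j + 1), 2) = ∑ j : ZMod n, c ((i, j), 2) :=
    Equiv.sum_comp (Equiv.addRight (1 : ZMod n)) fun j => c ((i, j), 2)
  simp only [Finset.sum_add_distrib] at hA hB
  rw [hs] at hB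
  exact add_left_cancel (hB.trans hA.symm)

/-- The phase `ω = exp (2πi/3)`. -/
def cubicOmega : ℂ := Complex.exp (2 * Real.pi * Complex.I / 3)

open Classical in
/-- The trimer state: the superposition of all valid configurations, where every folded trimer has
weight `ζ`. -/
def trimerState (m n : ℕ) [NeZero m] [NeZero n] (ζ : ℂ) : HilbertSpace m n :=
  WithLp.toLp 2 fun c => if Valid c then ζ ^ foldedCount c else 0

/-- The topological siblings of the trimer state: the amplitude of a configuration with windings
`N_h`, `N_v` is multiplied by the phase `ω ^ (ν_h N_h + ν_v N_v)`. -/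
def siblingState (m n : ℕ) [NeZero m] [NeZero n] (ζ : ℂ) (νh νv : ZMod 3) : HilbertSpace m n :=
  WithLp.toLp 2 fun c =>
    cubicOmega ^ (νh * windingH c + νv * windingV c).val * trimerState m n ζ c

theorem siblingState_zero (m n : ℕ) [NeZero m] [NeZero n] (ζ : ℂ) :
    siblingState m n ζ 0 0 = trimerState m n ζ := by
  ext c; simp [siblingState]

/-- The configuration that equals `x` on the edges in `R` and `s` on all others. -/
def glue {m n : ℕ} (R : Finset (Edge m n)) (x : LocalConfig R) (s : Config m n) : Config m n :=
  fun e => if h : e ∈ R then x ⟨e, h⟩ else s e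

/-- The operator `h ⊗ 1` on the whole Hilbert space, for an operator `h` on the edges in `R`. -/
def extendOp {m n : ℕ} [NeZero m] [NeZero n] (R : Finset (Edge m n))
    (h : Module.End ℂ (LocalSpace R)) : Module.End ℂ (HilbertSpace m n) where
  toFun ψ := WithLp.toLp 2 fun c =>
    h (WithLp.toLp 2 fun x => ψ (glue R x c)) fun e => c e
  map_add' ψ φ := by
    ext c
    exact congrArg (fun u : LocalSpace R => u fun e => c e)
      (h.map_add (WithLp.toLp 2 fun x => ψ (glue R x c)) (WithLp.toLp 2 fun x => φ (glue R x c)))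
  map_smul' a ψ := by
    ext c
    exact congrArg (fun u : LocalSpace R => u fun e => c e)
      (h.map_smul a (WithLp.toLp 2 fun x => ψ (glue R x c)))

/-- The span, on the three edges at `v`, of the allowed configurations. -/
def vertexGroundSpace {m n : ℕ} (v : Vertex m n) : Submodule ℂ (LocalSpace (vertexStar v)) :=
  Submodule.span ℂ {ψ | ∃ x : LocalConfig (vertexStar v),
    (∑ e, x e = 0 ∧ ∃ e, x e ≠ 0) ∧ ψ = EuclideanSpace.single x 1}

/-- The vertex term: the orthogonal projector whose kernel is `vertexGroundSpace v`, acting on the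
three edges at `v`. -/
def vertexTerm {m n : ℕ} [NeZero m] [NeZero n] (v : Vertex m n) : Module.End ℂ (HilbertSpace m n) :=
  extendOp (vertexStar v) ((vertexGroundSpace v)ᗮ.starProjection : LocalSpace (vertexStar v) →ₗ[ℂ] _)

open Classical in
/-- The weighted superposition of all configurations of the edges in `R` that are allowed when the
surrounding edges are in the configuration `s`. Only the vertices that touch `R` enter, so that it
depends on `s` only through the edges adjacent to `R`. -/
def boundaryState {m n : ℕ} [NeZero m] [NeZero n] (R : Finset (Edge m n)) (ζ : ℂ)
    (s : Config m n) : LocalSpace R :=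
  WithLp.toLp 2 fun x =>
    if ∀ v : Vertex m n, (vertexStar v ∩ R).Nonempty → AllowedAt v (glue R x s) then
      ζ ^ (Finset.univ.filter fun v : Vertex m n =>
        (vertexStar v ∩ R).Nonempty ∧ FoldedAt v (glue R x s)).card
    else 0

/-- The two-hexagon term: the orthogonal projector, acting on the edges of two adjacent hexagons,
whose kernel is spanned by the weighted superpositions of the allowed configurations for all choices
of the surrounding degrees of freedom. -/
def twoHexagonTerm {m n : ℕ} [NeZero m] [NeZero n] (ζ : ℂ) (p : Site m n) (d : Fin 3) :
    Module.End ℂ (HilbertSpace m n) :=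
  extendOp (twoHexagon p d)
    ((Submodule.span ℂ (Set.range (boundaryState (twoHexagon p d) ζ)))ᗮ.starProjection :
      LocalSpace (twoHexagon p d) →ₗ[ℂ] _)

/-- The two-hexagon parent Hamiltonian; the sums run over all vertices and over all pairs of
adjacent hexagons. -/
def hamiltonian (m n : ℕ) [NeZero m] [NeZero n] (ζ : ℂ) : Module.End ℂ (HilbertSpace m n) :=
  (∑ v : Vertex m n, vertexTerm v) + ∑ p : Site m n, ∑ d : Fin 3, twoHexagonTerm ζ p d

/-- The smallest real eigenvalue of an operator. -/
def groundEnergy {m n : ℕ} [NeZero m] [NeZero n] (H : Module.End ℂ (HilbertSpace m n)) : ℝ :=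
  sInf {E : ℝ | H.HasEigenvalue (E : ℂ)}

/-- The eigenspace of an operator for the smallest eigenvalue. -/
def groundSpace {m n : ℕ} [NeZero m] [NeZero n] (H : Module.End ℂ (HilbertSpace m n)) :
    Submodule ℂ (HilbertSpace m n) :=
  H.eigenspace (groundEnergy H : ℂ)

/-- A two-hexagon move: two valid configurations that differ only on the edges of two adjacent
hexagons. -/
def TwoHexagonMove {m n : ℕ} (c c' : Config m n) : Prop :=
  Valid c ∧ Valid c' ∧ ∃ (p : Site m n) (d : Fin 3), ∀ e ∉ twoHexagon p d, c e = c' e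

end TrimerModel

end

open TrimerModel

/-! Up to twists along the two loops, an edge configuration obeying the Gauss law is the gradient of a
`ℤ/3` colouring of the hexagons, that is of the sites of a triangular lattice. It is valid if no
triangle is monochromatic, and a two-hexagon move recolours two adjacent sites.

*Connectivity.* Every triangle contains a horizontal edge, so a configuration without monochromatic
horizontal edges ("row-proper") is valid, and its rows can be recoloured independently. Any valid
configuration can be made row-proper, as some move lowers the number of monochromatic horizontal
edges (`exists_move_of_not_rowProper`). Indeed, let `V` be the left end of such an edge, with a left
neighbour of another colour. Giving `V` the third colour fails only if this colour appears on both
ends of the edge above or of the edge below. Say above: then the edge above is in the same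
situation, but it cannot be blocked from below. So the obstruction continues along a diagonal, which
closes up on the torus; there, recolouring `V` together with the right end of the edge above it
removes both edges (`ne_zero_of_blocked`, which also treats monochromatic rows). Row-proper
configurations that differ by a recolouring are connected by recolouring one site after the other,
each with a neighbour in its row (`RowProper.reachable_add_coboundary`). Finally, configurations with
the same winding numbers differ by a recolouring (`exists_eq_coboundary`), and moves preserve the
winding numbers because some loop avoids the two hexagons.

*Ground space.* Every term is a projector tensored with the identity, and it annihilates a state
exactly if all slices of the state lie in the local kernel
(`extendOp_starProjection_eq_zero_iff`). A vertex touching two hexagons has at most one edge outside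
them, which the Gauss law determines; hence boundary states for different surroundings are equal or
have disjoint supports. So the zero-energy states are those supported on valid configurations whose
amplitudes, divided by the trimer weights, are invariant under moves (`hamiltonian_eq_zero_iff`). By
connectivity such a state is given by a function of the two winding numbers, all nine values of
which occur; the siblings correspond to the characters of `ℤ/3 × ℤ/3`, which are a basis of these
functions. -/

noncomputable section

namespace TrimerModel

/-! ### Configurations without monochromatic horizontal edges -/

/-- A property of the elements of a finite additive group that is preserved by adding `f` is
preserved by subtracting `f`, since `-f` is a multiple of `f`. -/
theorem sub_closed_of_add_closed {G : Type*} [AddCommGroup G] [Finite G] (f : G) {U : G → Prop}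
    (h : ∀ x, U x → U (x + f)) {x : G} (hx : U x) : U (x - f) := by
  have key : ∀ k : ℕ, U (x + k • f) := fun k => by
    induction k with
    | zero => simpa using hx
    | succ k ih => rw [succ_nsmul, ← add_assoc]; exact h _ ih
  have hpos := addOrderOf_pos f
  have h1 : (addOrderOf f - 1) • f = -f := by
    have h2 : (addOrderOf f - 1 + 1) • f = 0 := by
      rw [Nat.sub_add_cancel hpos]; exact addOrderOf_nsmul_eq_zero f
    rw [succ_nsmul] at h2
    exact eq_neg_of_add_eq_zero_left h2
  have := key (addOrderOf f - 1)
  rwa [h1, ← sub_eq_add_neg] at this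

/-- One half of `ne_zero_of_blocked`, where a monochromatic edge at `V` with a differently coloured
left neighbour is blocked by the edge at `V + f`. Such edges continue along the whole closed
diagonal in direction `f`, and then the blocking condition for pairs fails somewhere on it. -/
theorem false_of_blocked_chain {G : Type*} [AddCommGroup G] [Finite G] {e f g : G}
    (hefg : e + f + g = 0) {α β γ : G → ZMod 3}
    (hS : ∀ V t, α V = 0 → t ≠ 0 → t ≠ -α (V - e) →
      (α (V + f) = 0 ∧ β V = t) ∨ (α (V + g) = 0 ∧ γ V = t))
    (hP : ∀ V u, α V = 0 → α (V + f) = 0 → β V ≠ 0 → β V ≠ -α (V - e) →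
      ¬ (α (V + g) = 0 ∧ γ V = β V) → u ≠ 0 → u ≠ α (V + e + f) →
      α (V + e + f + f) = 0 ∧ β (V + e + f) = u)
    {V : G} (h0 : α V = 0) (hl : α (V - e) ≠ 0) (hf : α (V + f) = 0) (hb : β V = α (V - e)) :
    False := by
  have z3 : ∀ a : ZMod 3, a ≠ 0 → a ≠ -a := by decide
  have ne21 : (2 : ZMod 3) ≠ 1 := by decide
  let U : G → Prop := fun V => α V = 0 ∧ α (V - e) ≠ 0 ∧ α (V + f) = 0 ∧ β V = α (V - e)
  have hU : U V := ⟨h0, hl, hf, hb⟩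
  have hsucc : ∀ V, U V → U (V + f) := by
    rintro V ⟨-, h1, h2, -⟩
    have hg : V + f + g = V - e := by rw [add_assoc, sub_eq_add_neg]; congr 1; grind
    have hg' : α (V + f + g) ≠ 0 := by rwa [hg]
    have hS' : ∀ t, t ≠ 0 → t ≠ -α (V + f - e) → α (V + f + f) = 0 ∧ β (V + f) = t :=
      fun t ht ht' => (hS (V + f) t h2 ht ht').resolve_right fun h => hg' h.1
    have hl' : α (V + f - e) ≠ 0 := by
      intro h
      have a1 := (hS' 1 (by decide) (by rw [h]; decide)).2
      have a2 := (hS' 2 (by decide) (by rw [h]; decide)).2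
      exact ne21 (a2.symm.trans a1)
    have := hS' _ hl' (z3 _ hl')
    exact ⟨h2, hl', this.1, this.2⟩
  have hpair : ∀ V, U V → ∀ u, u ≠ 0 → u ≠ α (V + e + f) →
      α (V + e + f + f) = 0 ∧ β (V + e + f) = u := by
    intro V hV u
    have hback : U (V - f) := sub_closed_of_add_closed f hsucc hV
    obtain ⟨h1, h2, h3, h4⟩ := hV
    refine hP V u h1 h3 (h4 ▸ h2) (by rw [h4]; exact z3 _ h2) fun h => hback.2.1 ?_
    have : V - f - e = V + g := by grind
    rw [this]; exact h.1
  have hr : ∀ V, U V → α (V + e + f) ≠ 0 := by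
    intro V hV h
    have a1 := (hpair V hV 1 (by decide) (by rw [h]; decide)).2
    have a2 := (hpair V hV 2 (by decide) (by rw [h]; decide)).2
    exact ne21 (a2.symm.trans a1)
  have h1 := hr V hU
  have h2 := hr _ (hsucc V hU)
  have h3 := (hpair V hU (-α (V + e + f)) (neg_ne_zero.mpr h1) fun h => z3 _ h1 h.symm).1
  exact h2 (by rw [← h3]; congr 1; abel)

/-- Let `α`, `β`, `γ` be the differences of a colouring of the triangular lattice in the directions
`e`, `f`, `g` with `e + f + g = 0`. If every monochromatic edge in direction `e` is blocked, in the
sense that no recolouring of one site (`hS`) and no recolouring of two adjacent sites (`hPf`, `hPg`)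
removes it without creating a new one or a monochromatic triangle, then there is no monochromatic
edge in direction `e`. -/
theorem ne_zero_of_blocked {G : Type*} [AddCommGroup G] [Finite G] {e f g : G}
    (hefg : e + f + g = 0) {α β γ : G → ZMod 3}
    (hS : ∀ V t, α V = 0 → t ≠ 0 → t ≠ -α (V - e) →
      (α (V + f) = 0 ∧ β V = t) ∨ (α (V + g) = 0 ∧ γ V = t))
    (hPf : ∀ V u, α V = 0 → α (V + f) = 0 → β V ≠ 0 → β V ≠ -α (V - e) →
      ¬ (α (V + g) = 0 ∧ γ V = β V) → u ≠ 0 → u ≠ α (V + e + f) →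
      α (V + e + f + f) = 0 ∧ β (V + e + f) = u)
    (hPg : ∀ V u, α V = 0 → α (V + g) = 0 → γ V ≠ 0 → γ V ≠ -α (V - e) →
      ¬ (α (V + f) = 0 ∧ β V = γ V) → u ≠ 0 → u ≠ α (V + e + g) →
      α (V + e + g + g) = 0 ∧ γ (V + e + g) = u)
    (V : G) : α V ≠ 0 := by
  intro h0
  have z3 : ∀ a : ZMod 3, a ≠ 0 → a ≠ -a := by decide
  have ne21 : (2 : ZMod 3) ≠ 1 := by decide
  have ne20 : (2 : ZMod 3) ≠ 0 := by decide
  by_cases hB : ∀ V, α V = 0 → α (V - e) = 0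
  · -- The row of `V` is monochromatic, and one colour for `V` is blocked by the edge at `V + f`.
    have hB' : ∀ V, α V = 0 → α (V + e) = 0 := fun V hV => by
      have := sub_closed_of_add_closed (U := fun V => α V = 0) (-e)
        (fun x hx => by simpa [sub_eq_add_neg] using hB x hx) hV
      simpa using this
    have hS' : ∀ t, t ≠ 0 → (α (V + f) = 0 ∧ β V = t) ∨ (α (V + g) = 0 ∧ γ V = t) :=
      fun t ht => hS V t h0 ht (by rw [hB V h0, neg_zero]; exact ht)
    obtain ⟨hf, hb, hn⟩ : α (V + f) = 0 ∧ β V ≠ 0 ∧ ¬ (α (V + g) = 0 ∧ γ V = β V) := by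
      rcases hS' 1 one_ne_zero with h1 | h1 <;> rcases hS' 2 ne20 with h2 | h2
      · exact absurd (h2.2.symm.trans h1.2) ne21
      · exact ⟨h1.1, h1.2 ▸ one_ne_zero, fun h => ne21 (by rw [← h1.2, ← h.2, h2.2])⟩
      · exact ⟨h2.1, h2.2 ▸ ne20, fun h => ne21 (by rw [← h2.2, ← h.2, h1.2])⟩
      · exact absurd (h2.2.symm.trans h1.2) ne21
    have hr : α (V + e + f) = 0 := by
      have := hB' _ hf
      rwa [show V + f + e = V + e + f by abel] at this
    have hP : ∀ u, u ≠ 0 → β (V + e + f) = u := fun u hu =>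
      (hPf V u h0 hf hb (by rw [hB V h0, neg_zero]; exact hb) hn hu (by rw [hr]; exact hu)).2
    exact ne21 ((hP 2 ne20).symm.trans (hP 1 one_ne_zero))
  · push Not at hB
    obtain ⟨W, hW, hl⟩ := hB
    rcases hS W _ hW hl (z3 _ hl) with h | h
    · exact false_of_blocked_chain hefg hS hPf hW hl h.1 h.2
    · exact false_of_blocked_chain (f := g) (g := f) (by rw [← hefg]; abel)
        (fun V t a b c => (hS V t a b c).symm) hPg hW hl h.1 h.2

/-! ### Recolouring sites -/

variable {m n : ℕ}

/-- The change of the edge variables when the colour of each hexagon `p` is raised by `σ p`; the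
edge variables are the colour differences of the two hexagons at the edge, read
counterclockwise around the `A`-vertex. -/
def coboundary (σ : Site m n → ZMod 3) : Config m n := fun e =>
  ![σ (e.1 + (0, 1)) - σ (e.1 + (1, 0)), σ e.1 - σ (e.1 + (0, 1)), σ (e.1 + (1, 0)) - σ e.1] e.2

@[simp] theorem coboundary_zero_dir (σ : Site m n → ZMod 3) (p : Site m n) :
    coboundary σ (p, 0) = σ (p + (0, 1)) - σ (p + (1, 0)) := rfl

@[simp] theorem coboundary_one_dir (σ : Site m n → ZMod 3) (p : Site m n) :
    coboundary σ (p, 1) = σ p - σ (p + (0, 1)) := rfl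

@[simp] theorem coboundary_two_dir (σ : Site m n → ZMod 3) (p : Site m n) :
    coboundary σ (p, 2) = σ (p + (1, 0)) - σ p := rfl

theorem coboundary_add (σ τ : Site m n → ZMod 3) :
    coboundary (σ + τ) = coboundary σ + coboundary τ := by
  ext ⟨p, k⟩
  fin_cases k <;> simp <;> ring

theorem coboundary_zero : coboundary (0 : Site m n → ZMod 3) = 0 := by
  ext ⟨p, k⟩
  fin_cases k <;> simp

/-- The Gauss law: the edge variables at every vertex sum to zero. -/
def Gauss (c : Config m n) : Prop :=
  (∀ p, c (p, 0) + c (p, 1) + c (p, 2) = 0) ∧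
    ∀ p, c (p, 0) + c (p + (1, 0), 1) + c (p + (0, 1), 2) = 0

theorem gauss_coboundary (σ : Site m n → ZMod 3) : Gauss (coboundary σ) := by
  constructor <;> intro p <;> simp only [coboundary_zero_dir, coboundary_one_dir,
    coboundary_two_dir]
  · ring
  · rw [add_right_comm p (0, 1) (1, 0)]; ring

theorem Gauss.add {c c' : Config m n} (h : Gauss c) (h' : Gauss c') : Gauss (c + c') := by
  constructor <;> intro p
  · have h1 := h.1 p
    have h2 := h'.1 p
    simp only [Pi.add_apply]
    linear_combination h1 + h2
  · have h1 := h.2 p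
    have h2 := h'.2 p
    simp only [Pi.add_apply]
    linear_combination h1 + h2

theorem Gauss.neg {c : Config m n} (h : Gauss c) : Gauss (-c) := by
  constructor <;> intro p
  · have h1 := h.1 p
    simp only [Pi.neg_apply]
    linear_combination -h1
  · have h1 := h.2 p
    simp only [Pi.neg_apply]
    linear_combination -h1

theorem valid_iff {c : Config m n} : Valid c ↔ Gauss c ∧
    (∀ p, ¬ (c (p, 0) = 0 ∧ c (p, 1) = 0 ∧ c (p, 2) = 0)) ∧
    ∀ p, ¬ (c (p, 0) = 0 ∧ c (p + (1, 0), 1) = 0 ∧ c (p + (0, 1), 2) = 0) := by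
  unfold Valid AllowedAt Gauss
  rw [Sum.forall]
  simp only [sum_vertexStar_inl, sum_vertexStar_inr, forall_and]
  simp only [vertexStar, Finset.mem_insert, Finset.mem_singleton, exists_eq_or_imp,
    exists_eq_left, ne_eq, not_and_or]
  tauto

theorem Valid.gauss {c : Config m n} (h : Valid c) : Gauss c := (valid_iff.mp h).1

/-- A configuration is row-proper if no two neighbouring hexagons in a row have the same colour.
As every vertex lies on an edge between such hexagons, this implies that the configuration is not
`000` anywhere. -/
def RowProper (c : Config m n) : Prop := Gauss c ∧ ∀ p, c (p, 2) ≠ 0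

theorem RowProper.valid {c : Config m n} (h : RowProper c) : Valid c :=
  valid_iff.mpr ⟨h.1, fun p hp => h.2 p hp.2.2, fun _ hp => h.2 _ hp.2.2⟩

theorem mem_hexagon_zero_dir {q r : Site m n} :
    (r, 0) ∈ hexagon q ↔ q = r + (0, 1) ∨ q = r + (1, 0) := by
  simp [hexagon, eq_sub_iff_add_eq, eq_comm (a := q), or_comm]

theorem mem_hexagon_one_dir {q r : Site m n} :
    (r, 1) ∈ hexagon q ↔ q = r ∨ q = r + (0, 1) := by
  simp [hexagon, eq_sub_iff_add_eq, eq_comm (a := q)]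

theorem mem_hexagon_two_dir {q r : Site m n} :
    (r, 2) ∈ hexagon q ↔ q = r ∨ q = r + (1, 0) := by
  simp [hexagon, eq_sub_iff_add_eq, eq_comm (a := q)]

/-- Raising the colours of two adjacent hexagons is a two-hexagon move. -/
theorem twoHexagonMove_add_coboundary {c : Config m n} {σ : Site m n → ZMod 3}
    (hc : Valid c) (hc' : Valid (c + coboundary σ)) (p : Site m n) (d : Fin 3)
    (hσ : ∀ q, q ≠ p → q ≠ p + direction d → σ q = 0) :
    TwoHexagonMove c (c + coboundary σ) := by
  refine ⟨hc, hc', p, d, ?_⟩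
  rintro ⟨r, k⟩ he
  rw [twoHexagon, Finset.mem_union, not_or] at he
  obtain ⟨h1, h2⟩ := he
  have h3 : ∀ q, (p ≠ q ∧ p + direction d ≠ q) → σ q = 0 := fun q hq => hσ q hq.1.symm hq.2.symm
  rw [Pi.add_apply, left_eq_add]
  fin_cases k
  · simp only [Fin.zero_eta, mem_hexagon_zero_dir, not_or] at h1 h2
    simp only [Fin.zero_eta, coboundary_zero_dir]
    rw [h3 _ ⟨h1.1, h2.1⟩, h3 _ ⟨h1.2, h2.2⟩, sub_zero]
  · simp only [Fin.mk_one, mem_hexagon_one_dir, not_or] at h1 h2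
    simp only [Fin.mk_one, coboundary_one_dir]
    rw [h3 _ ⟨h1.1, h2.1⟩, h3 _ ⟨h1.2, h2.2⟩, sub_zero]
  · simp only [Fin.reduceFinMk, mem_hexagon_two_dir, not_or] at h1 h2
    simp only [Fin.reduceFinMk, coboundary_two_dir]
    rw [h3 _ ⟨h1.1, h2.1⟩, h3 _ ⟨h1.2, h2.2⟩, sub_zero]

theorem TwoHexagonMove.symm {c c' : Config m n} (h : TwoHexagonMove c c') :
    TwoHexagonMove c' c := by
  obtain ⟨h1, h2, p, d, h3⟩ := h
  exact ⟨h2, h1, p, d, fun e he => (h3 e he).symm⟩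

/-- Recolouring by `σ` keeps a configuration valid if every horizontal edge that is monochromatic
afterwards has unchanged ends and no opposite hexagon that is raised to the same colour. -/
theorem valid_add_coboundary {c : Config m n} (hc : Valid c) (σ : Site m n → ZMod 3)
    (h : ∀ x, c (x, 2) + (σ (x + (1, 0)) - σ x) = 0 → σ x = 0 ∧ σ (x + (1, 0)) = 0 ∧
      (σ (x + (0, 1)) ≠ 0 → c (x, 1) ≠ σ (x + (0, 1))) ∧
      (σ (x + (1, -1)) ≠ 0 → c (x - (0, 1), 0) ≠ σ (x + (1, -1)))) :
    Valid (c + coboundary σ) := by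
  obtain ⟨hg, hA, hB⟩ := valid_iff.mp hc
  refine valid_iff.mpr ⟨hg.add (gauss_coboundary σ), fun x hx => ?_, fun y hy => ?_⟩
  · simp only [Pi.add_apply, coboundary_zero_dir, coboundary_one_dir, coboundary_two_dir] at hx
    obtain ⟨h1, h2, h3, -⟩ := h x hx.2.2
    have h4 : c (x, 1) = σ (x + (0, 1)) := by
      have := hx.2.1
      rw [h1] at this
      linear_combination this
    have h5 : c (x, 2) = 0 := by simpa [h1, h2] using hx.2.2
    by_cases h6 : σ (x + (0, 1)) = 0
    · have h7 : c (x, 0) = 0 := by simpa [h2, h6] using hx.1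
      exact hA x ⟨h7, h4.trans h6, h5⟩
    · exact h3 h6 h4
  · simp only [Pi.add_apply, coboundary_zero_dir, coboundary_one_dir, coboundary_two_dir] at hy
    obtain ⟨h1, h2, -, h3⟩ := h (y + (0, 1)) hy.2.2
    have e1 : y + (0, 1) + (1, -1) = y + (1, 0) := by
      rw [add_assoc]; simp
    rw [e1, add_sub_cancel_right] at h3
    have h4 : c (y, 0) = σ (y + (1, 0)) := by
      have := hy.1
      rw [h1] at this
      linear_combination this
    have h5 : c (y + (0, 1), 2) = 0 := by simpa [h1, h2] using hy.2.2
    by_cases h6 : σ (y + (1, 0)) = 0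
    · have h7 : c (y + (1, 0), 1) = 0 := by
        have h2' : σ (y + (1, 0) + (0, 1)) = 0 := by rw [add_right_comm]; exact h2
        simpa [h2', h6] using hy.2.1
      exact hB y ⟨h4.trans h6, h7, h5⟩
    · exact h3 h6 h4

theorem zmod_one_ne_zero (hm : 3 ≤ m) : (1 : ZMod m) ≠ 0 := by
  have := (ZMod.natCast_eq_zero_iff 1 m).not.mpr (Nat.not_dvd_of_pos_of_lt one_pos (by omega))
  simpa using this

theorem zmod_two_ne_zero (hm : 3 ≤ m) : (2 : ZMod m) ≠ 0 := by
  have := (ZMod.natCast_eq_zero_iff 2 m).not.mpr (Nat.not_dvd_of_pos_of_lt two_pos (by omega))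
  simpa using this

/-- The recolouring that raises `V` by `t` and `R` by `u`. -/
def pairBump (V R : Site m n) (t u : ZMod 3) : Site m n → ZMod 3 :=
  fun x => if x = V then t else if x = R then u else 0

theorem pairBump_left (V R : Site m n) (t u : ZMod 3) : pairBump V R t u V = t := by
  simp [pairBump]

theorem pairBump_right {V R : Site m n} (h : R ≠ V) (t u : ZMod 3) :
    pairBump V R t u R = u := by
  simp [pairBump, h]

theorem pairBump_of_ne {V R x : Site m n} (h : x ≠ V) (h' : x ≠ R) (t u : ZMod 3) :
    pairBump V R t u x = 0 := by
  simp [pairBump, h, h']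

theorem eq_or_eq_of_pairBump_ne_zero {V R x : Site m n} {t u : ZMod 3}
    (h : pairBump V R t u x ≠ 0) : (x = V ∧ pairBump V R t u x = t) ∨
      (x = R ∧ pairBump V R t u x = u) := by
  unfold pairBump at *
  split_ifs at * <;> simp_all

/-- The number of monochromatic horizontal edges. -/
def flatCount [NeZero m] [NeZero n] (c : Config m n) : ℕ :=
  (Finset.univ.filter fun x : Site m n => c (x, 2) = 0).card

/-- If a recolouring changes an end of a monochromatic horizontal edge, and leaves unchanged both ends
of every horizontal edge that is monochromatic afterwards, then it lowers the number of such
edges. -/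
theorem flatCount_lt [NeZero m] [NeZero n] {c : Config m n} {σ : Site m n → ZMod 3}
    (h : ∀ x, c (x, 2) + (σ (x + (1, 0)) - σ x) = 0 → σ x = 0 ∧ σ (x + (1, 0)) = 0)
    {V : Site m n} (hV : c (V, 2) = 0) (hσ : σ V ≠ 0) :
    flatCount (c + coboundary σ) < flatCount c := by
  refine Finset.card_lt_card (Finset.ssubset_iff_of_subset ?_ |>.mpr ⟨V, by simpa using hV, ?_⟩)
  · intro x hx
    rw [Finset.mem_filter_univ] at hx ⊢
    rw [Pi.add_apply, coboundary_two_dir] at hx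
    obtain ⟨h1, h2⟩ := h x hx
    simpa [h1, h2] using hx
  · rw [Finset.mem_filter_univ, Pi.add_apply, coboundary_two_dir]
    exact fun hx => hσ (h V hx).1

/-- Conditions on the recolouring of two adjacent hexagons `V` and `R` under which it is a
two-hexagon move that lowers the number of monochromatic horizontal edges. -/
theorem exists_move_flatCount_lt [NeZero m] [NeZero n] {c : Config m n} (hc : Valid c)
    (V R : Site m n) (t u : ZMod 3) (hV : c (V, 2) = 0) (ht : t ≠ 0)
    (hadj : ∃ p d, (V = p ∧ R = p + direction d) ∨ (R = p ∧ V = p + direction d))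
    (hflat : ∀ x, c (x, 2) + (pairBump V R t u (x + (1, 0)) - pairBump V R t u x) = 0 →
      pairBump V R t u x = 0 ∧ pairBump V R t u (x + (1, 0)) = 0)
    (h1 : ∀ x, c (x, 2) + (pairBump V R t u (x + (1, 0)) - pairBump V R t u x) = 0 →
      c (x, 2) = 0 →
      (pairBump V R t u (x + (0, 1)) ≠ 0 → c (x, 1) ≠ pairBump V R t u (x + (0, 1))) ∧
      (pairBump V R t u (x + (1, -1)) ≠ 0 →
        c (x - (0, 1), 0) ≠ pairBump V R t u (x + (1, -1)))) :
    ∃ c', TwoHexagonMove c c' ∧ flatCount c' < flatCount c := by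
  refine ⟨c + coboundary (pairBump V R t u), ?_,
    flatCount_lt hflat hV (by rwa [pairBump_left])⟩
  obtain ⟨p, d, hpd⟩ := hadj
  refine twoHexagonMove_add_coboundary hc (valid_add_coboundary hc _ fun x hx => ?_) p d ?_
  · obtain ⟨h2, h3⟩ := hflat x hx
    exact ⟨h2, h3, h1 x hx (by simpa [h2, h3] using hx)⟩
  · intro q hq hq'
    rcases hpd with ⟨rfl, rfl⟩ | ⟨rfl, rfl⟩
    · exact pairBump_of_ne hq hq' _ _
    · exact pairBump_of_ne hq' hq _ _

/-- Recolouring the left end `V` of a monochromatic edge. The new colour must differ from that of the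
left neighbour (`hl`), and must not complete a monochromatic triangle with the pair above (`hf`) or
the pair below (`hg`). -/
theorem exists_single_move [NeZero m] [NeZero n] (hm : 3 ≤ m) {c : Config m n}
    (hc : Valid c) (V : Site m n) (t : ZMod 3) (hV : c (V, 2) = 0) (ht : t ≠ 0)
    (hl : t ≠ -c (V - (1, 0), 2))
    (hf : ¬ (c (V + (-1, 1), 2) = 0 ∧ c (V - (1, 0), 0) = t))
    (hg : ¬ (c (V + (0, -1), 2) = 0 ∧ c (V - (0, 1), 1) = t)) :
    ∃ c', TwoHexagonMove c c' ∧ flatCount c' < flatCount c := by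
  have m1 := zmod_one_ne_zero hm
  have key : ∀ x, pairBump V (V + (1, 0)) t 0 x = if x = V then t else 0 := fun x => by
    simp [pairBump]
  refine exists_move_flatCount_lt hc V (V + (1, 0)) t 0 hV ht
    ⟨V, 0, Or.inl ⟨rfl, rfl⟩⟩ ?_ ?_
  · intro x hx
    simp only [key] at hx ⊢
    have hx1 : x ≠ V := by
      rintro rfl
      simp [hV, ht, m1] at hx
    have hx2 : x + (1, 0) ≠ V := by
      rintro rfl
      rw [if_pos rfl, if_neg hx1, add_sub_cancel_right] at *
      exact hl (by linear_combination hx)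
    simp [hx1, hx2]
  · intro x _ h0
    simp only [key]
    constructor
    · intro h
      obtain rfl : x + (0, 1) = V := by by_contra h'; exact h (if_neg h')
      rw [if_pos rfl]
      intro h'
      refine hg ⟨?_, by simpa using h'⟩
      rwa [add_assoc, show ((0, 1) : Site m n) + (0, -1) = 0 by simp, add_zero]
    · intro h
      obtain rfl : x + (1, -1) = V := by by_contra h'; exact h (if_neg h')
      rw [if_pos rfl]
      intro h'
      refine hf ⟨?_, ?_⟩
      · rwa [add_assoc, show ((1, -1) : Site m n) + (-1, 1) = 0 by simp, add_zero]
      · rw [← h']; congr 2; ext <;> simp [sub_eq_add_neg]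

/-- The left ends `V` and `V + (-1, 1)` of two stacked monochromatic edges: `V` is recoloured together
with `V + (0, 1)`, the right end of the upper edge, which otherwise could block `V`. -/
theorem exists_pair_move_up [NeZero m] [NeZero n] (hm : 3 ≤ m) (hn : 3 ≤ n) {c : Config m n}
    (hc : Valid c) (V : Site m n) (t u : ZMod 3) (hV : c (V, 2) = 0)
    (hVf : c (V + (-1, 1), 2) = 0) (ht : t ≠ 0)
    (hl : t ≠ -c (V - (1, 0), 2))
    (hg : ¬ (c (V + (0, -1), 2) = 0 ∧ c (V - (0, 1), 1) = t))
    (hu : u ≠ 0) (hr : u ≠ c (V + (0, 1), 2))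
    (hff : ¬ (c (V + (-1, 2), 2) = 0 ∧ c (V + (-1, 1), 0) = u)) :
    ∃ c', TwoHexagonMove c c' ∧ flatCount c' < flatCount c := by
  have m1 := zmod_one_ne_zero hm
  have n1 := zmod_one_ne_zero hn
  obtain ⟨i, j⟩ := V
  have hne : ((i, j) : Site m n) + (0, 1) ≠ (i, j) := by simp [n1]
  -- The four horizontal edges at the two recoloured hexagons are not monochromatic afterwards.
  have hflat : ∀ x, c (x, 2) + (pairBump (i, j) ((i, j) + (0, 1)) t u (x + (1, 0)) -
      pairBump (i, j) ((i, j) + (0, 1)) t u x) = 0 → x ≠ (i, j) ∧ x + (1, 0) ≠ (i, j) ∧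
        x ≠ (i, j) + (0, 1) ∧ x + (1, 0) ≠ (i, j) + (0, 1) := by
    rintro x hx
    refine ⟨?_, ?_, ?_, ?_⟩
    · rintro rfl
      rw [pairBump_left, pairBump_of_ne (by simp [m1]) (by simp [m1])] at hx
      simp [hV, ht] at hx
    · intro h
      obtain rfl := eq_sub_of_add_eq h
      rw [h, pairBump_left, pairBump_of_ne (by simp [m1]) (by simp [n1])] at hx
      exact hl (by linear_combination hx)
    · rintro rfl
      rw [pairBump_right hne, pairBump_of_ne (by simp [n1]) (by simp [m1])] at hx
      exact hr (by linear_combination -hx)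
    · intro h
      obtain rfl := eq_sub_of_add_eq h
      rw [h, pairBump_right hne, pairBump_of_ne (by simp [n1]) (by simp [m1])] at hx
      have : c ((i, j) + (0, 1) - (1, 0), 2) = 0 := by
        rw [← hVf]; congr 2; ext <;> simp [sub_eq_add_neg]
      rw [this] at hx
      exact hu (by linear_combination hx)
  refine exists_move_flatCount_lt hc (i, j) ((i, j) + (0, 1)) t u hV ht
    ⟨(i, j), 1, Or.inl ⟨rfl, rfl⟩⟩ ?_ ?_
  · intro x hx
    obtain ⟨h1, h2, h3, h4⟩ := hflat x hx
    exact ⟨pairBump_of_ne h1 h3 _ _, pairBump_of_ne h2 h4 _ _⟩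
  · intro x hx h0
    obtain ⟨h1, h2, h3, h4⟩ := hflat x hx
    constructor
    · intro h
      rcases eq_or_eq_of_pairBump_ne_zero h with ⟨h5, h6⟩ | ⟨h5, h6⟩
      · rw [h6]
        obtain rfl := eq_sub_of_add_eq h5
        exact fun h' => hg ⟨by rw [← h0]; congr 2; ext <;> simp [sub_eq_add_neg], h'⟩
      · exact absurd (add_right_cancel h5) h1
    · intro h
      rcases eq_or_eq_of_pairBump_ne_zero h with ⟨h5, h6⟩ | ⟨h5, h6⟩
      · obtain rfl := eq_sub_of_add_eq h5
        exact absurd (by ext <;> simp) h4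
      · rw [h6]
        obtain rfl := eq_sub_of_add_eq h5
        refine fun h' => hff ⟨?_, ?_⟩
        · rw [← h0]; congr 2; ext <;> simp [sub_eq_add_neg]; ring
        · rw [← h']; congr 2; ext <;> simp [sub_eq_add_neg]

/-- The mirror image of `exists_pair_move_up`: `V` is recoloured together with `V + (1, -1)`, the right
end of the monochromatic edge below. -/
theorem exists_pair_move_down [NeZero m] [NeZero n] (hm : 3 ≤ m) (hn : 3 ≤ n) {c : Config m n}
    (hc : Valid c) (V : Site m n) (t u : ZMod 3) (hV : c (V, 2) = 0)
    (hVg : c (V + (0, -1), 2) = 0) (ht : t ≠ 0)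
    (hl : t ≠ -c (V - (1, 0), 2))
    (hf : ¬ (c (V + (-1, 1), 2) = 0 ∧ c (V - (1, 0), 0) = t))
    (hu : u ≠ 0) (hr : u ≠ c (V + (1, -1), 2))
    (hgg : ¬ (c (V + (1, -2), 2) = 0 ∧ c (V + (1, -2), 1) = u)) :
    ∃ c', TwoHexagonMove c c' ∧ flatCount c' < flatCount c := by
  have m1 := zmod_one_ne_zero hm
  have n1 := zmod_one_ne_zero hn
  obtain ⟨i, j⟩ := V
  have hne : ((i, j) : Site m n) + (1, -1) ≠ (i, j) := by simp [n1]
  -- The four horizontal edges at the two recoloured hexagons are not monochromatic afterwards.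
  have hflat : ∀ x, c (x, 2) + (pairBump (i, j) ((i, j) + (1, -1)) t u (x + (1, 0)) -
      pairBump (i, j) ((i, j) + (1, -1)) t u x) = 0 → x ≠ (i, j) ∧ x + (1, 0) ≠ (i, j) ∧
        x ≠ (i, j) + (1, -1) ∧ x + (1, 0) ≠ (i, j) + (1, -1) := by
    rintro x hx
    refine ⟨?_, ?_, ?_, ?_⟩
    · rintro rfl
      rw [pairBump_left, pairBump_of_ne (by simp [m1]) (by simp [n1])] at hx
      simp [hV, ht] at hx
    · intro h
      obtain rfl := eq_sub_of_add_eq h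
      rw [h, pairBump_left, pairBump_of_ne (by simp [m1]) (by simp [n1])] at hx
      exact hl (by linear_combination hx)
    · rintro rfl
      rw [pairBump_right hne, pairBump_of_ne (by simp [n1]) (by simp [m1])] at hx
      exact hr (by linear_combination -hx)
    · intro h
      obtain rfl := eq_sub_of_add_eq h
      rw [h, pairBump_right hne, pairBump_of_ne (by simp [n1]) (by simp [m1])] at hx
      have : c ((i, j) + (1, -1) - (1, 0), 2) = 0 := by
        rw [← hVg]; congr 2; ext <;> simp [sub_eq_add_neg]
      rw [this] at hx
      exact hu (by linear_combination hx)
  refine exists_move_flatCount_lt hc (i, j) ((i, j) + (1, -1)) t u hV ht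
    ⟨(i, j) + (1, -1), 2, Or.inr ⟨rfl, by ext <;> simp [direction]⟩⟩ ?_ ?_
  · intro x hx
    obtain ⟨h1, h2, h3, h4⟩ := hflat x hx
    exact ⟨pairBump_of_ne h1 h3 _ _, pairBump_of_ne h2 h4 _ _⟩
  · intro x hx h0
    obtain ⟨h1, h2, h3, h4⟩ := hflat x hx
    constructor
    · intro h
      rcases eq_or_eq_of_pairBump_ne_zero h with ⟨h5, h6⟩ | ⟨h5, h6⟩
      · obtain rfl := eq_sub_of_add_eq h5
        exact absurd (by ext <;> simp [sub_eq_add_neg]) h4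
      · rw [h6]
        obtain rfl := eq_sub_of_add_eq h5
        refine fun h' => hgg ⟨?_, ?_⟩
        · rw [← h0]; congr 2; ext <;> simp [sub_eq_add_neg]; ring
        · rw [← h']; congr 2; ext <;> simp [sub_eq_add_neg]; ring
    · intro h
      rcases eq_or_eq_of_pairBump_ne_zero h with ⟨h5, h6⟩ | ⟨h5, h6⟩
      · rw [h6]
        obtain rfl := eq_sub_of_add_eq h5
        refine fun h' => hf ⟨?_, ?_⟩
        · rw [← h0]; congr 2; ext <;> simp [sub_eq_add_neg]
        · rw [← h']; congr 2; ext <;> simp [sub_eq_add_neg]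
      · exact absurd (add_right_cancel h5) h1

/-- A monochromatic horizontal edge can always be removed by some two-hexagon move. -/
theorem exists_move_of_not_rowProper [NeZero m] [NeZero n] (hm : 3 ≤ m) (hn : 3 ≤ n)
    {c : Config m n} (hc : Valid c) (h : ¬ RowProper c) :
    ∃ c', TwoHexagonMove c c' ∧ flatCount c' < flatCount c := by
  by_contra hno
  refine h ⟨hc.gauss, ne_zero_of_blocked (e := (1, 0)) (f := (-1, 1)) (g := (0, -1))
    (α := fun p => c (p, 2)) (β := fun p => c (p - (1, 0), 0)) (γ := fun p => c (p - (0, 1), 1))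
    (by simp) ?_ ?_ ?_⟩
  · intro V t hV ht hl
    by_contra h'
    rw [not_or] at h'
    exact hno (exists_single_move hm hc V t hV ht hl h'.1 h'.2)
  · intro V u hV hVf hb hl hg hu hr
    by_contra h'
    have e1 : V + (1, 0) + (-1, 1) = V + (0, 1) := by rw [add_assoc]; simp
    have e2 : V + (0, 1) + (-1, 1) = V + (-1, 2) := by rw [add_assoc]; norm_num
    have e3 : V + (0, 1) - (1, 0) = V + (-1, 1) := by rw [add_sub_assoc]; simp
    rw [e1] at h' hr
    rw [e2, e3] at h'
    exact hno (exists_pair_move_up hm hn hc V _ u hV hVf hb hl hg hu hr h')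
  · intro V u hV hVg hb hl hf hu hr
    by_contra h'
    have e1 : V + (1, 0) + (0, -1) = V + (1, -1) := by rw [add_assoc]; simp
    have e2 : V + (1, -1) + (0, -1) = V + (1, -2) := by rw [add_assoc]; norm_num
    have e3 : V + (1, -1) - (0, 1) = V + (1, -2) := by rw [add_sub_assoc]; norm_num
    rw [e1] at h' hr
    rw [e2, e3] at h'
    exact hno (exists_pair_move_down hm hn hc V _ u hV hVg hb hl hf hu hr h')

theorem exists_rowProper_reachable [NeZero m] [NeZero n] (hm : 3 ≤ m) (hn : 3 ≤ n)
    {c : Config m n} (hc : Valid c) :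
    ∃ c', RowProper c' ∧ Relation.ReflTransGen TwoHexagonMove c c' := by
  induction hk : flatCount c using Nat.strong_induction_on generalizing c with
  | _ k ih =>
    by_cases h : RowProper c
    · exact ⟨c, h, .refl⟩
    · obtain ⟨c₁, hmove, hlt⟩ := exists_move_of_not_rowProper hm hn hc h
      obtain ⟨c₂, h2, h3⟩ := ih _ (hk ▸ hlt) hmove.2.1 rfl
      exact ⟨c₂, h2, .head hmove h3⟩

/-! ### Connecting row-proper configurations -/

/-- Recolouring two neighbouring hexagons of a row so that the row stays proper is a two-hexagon
move, since the other rows impose no constraint. -/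
theorem RowProper.add_pairBump (hm : 3 ≤ m) {c : Config m n} (hc : RowProper c) (p : Site m n)
    (t u : ZMod 3) (h1 : c (p - (1, 0), 2) + t ≠ 0) (h2 : c (p, 2) - t + u ≠ 0)
    (h3 : c (p + (1, 0), 2) - u ≠ 0) :
    RowProper (c + coboundary (pairBump p (p + (1, 0)) t u)) ∧
      TwoHexagonMove c (c + coboundary (pairBump p (p + (1, 0)) t u)) := by
  have m1 := zmod_one_ne_zero hm
  have m2 := zmod_two_ne_zero hm
  have hne : p + (1, 0) ≠ p := by simp [m1]
  have hne2 : p + (1, 0) + (1, 0) ≠ p := by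
    rw [add_assoc]
    simpa [one_add_one_eq_two] using m2
  have hrow : RowProper (c + coboundary (pairBump p (p + (1, 0)) t u)) := by
    refine ⟨hc.1.add (gauss_coboundary _), fun x => ?_⟩
    rw [Pi.add_apply, coboundary_two_dir]
    by_cases hx : x = p
    · subst hx
      rw [pairBump_left, pairBump_right hne]
      intro h
      exact h2 (by linear_combination h)
    by_cases hx' : x = p + (1, 0)
    · subst hx'
      rw [pairBump_right hne, pairBump_of_ne hne2 (by simp [m1])]
      intro h
      exact h3 (by linear_combination h)
    rw [pairBump_of_ne hx hx']
    by_cases hx'' : x + (1, 0) = p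
    · rw [hx'', pairBump_left, sub_zero]
      rwa [← hx'', add_sub_cancel_right] at h1
    · rw [pairBump_of_ne hx'' fun h => hx (add_right_cancel h), sub_zero, add_zero]
      exact hc.2 x
  exact ⟨hrow, twoHexagonMove_add_coboundary hc.valid hrow.valid p 0
    fun q hq hq' => pairBump_of_ne hq hq' _ _⟩

/-- Two row-proper configurations that differ by a recolouring are connected. The induction is on
the number of hexagons whose colours differ: one of them is given its final colour while the
others that are touched differ as well. -/
theorem RowProper.reachable_add_coboundary [NeZero m] [NeZero n] (hm : 3 ≤ m)
    {c : Config m n} (hc : RowProper c) (σ : Site m n → ZMod 3)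
    (hc' : RowProper (c + coboundary σ)) :
    Relation.ReflTransGen TwoHexagonMove c (c + coboundary σ) := by
  induction hk : (Finset.univ.filter fun x => σ x ≠ 0).card using Nat.strong_induction_on
    generalizing c σ with
  | _ k ih =>
    have m1 := zmod_one_ne_zero hm
    have m2 := zmod_two_ne_zero hm
    have step : ∀ (τ : Site m n → ZMod 3) (p : Site m n), σ p ≠ 0 → τ p = σ p →
        (∀ x, σ x = 0 → τ x = 0) → RowProper (c + coboundary τ) →
        Relation.ReflTransGen TwoHexagonMove c (c + coboundary τ) →
        Relation.ReflTransGen TwoHexagonMove c (c + coboundary σ) := by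
      intro τ p hp hτp hτ hrow hreach
      have e : c + coboundary σ = c + coboundary τ + coboundary (σ - τ) := by
        rw [add_assoc, ← coboundary_add, add_sub_cancel]
      rw [e] at hc' ⊢
      refine hreach.trans (ih _ ?_ hrow (σ - τ) hc' rfl)
      rw [← hk]
      refine Finset.card_lt_card (Finset.ssubset_iff_of_subset ?_ |>.mpr ⟨p, ?_, ?_⟩)
      · intro x hx
        rw [Finset.mem_filter_univ] at hx ⊢
        intro h
        exact hx (by rw [Pi.sub_apply, h, hτ x h, sub_zero])
      · rwa [Finset.mem_filter_univ]
      · rw [Finset.mem_filter_univ, not_not, Pi.sub_apply, hτp, sub_self]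
    by_cases h0 : ∀ x, σ x = 0
    · rw [show σ = 0 from funext h0, coboundary_zero, add_zero]
    push Not at h0
    have hfin : ∀ x, c (x, 2) + (σ (x + (1, 0)) - σ x) ≠ 0 := fun x => hc'.2 x
    by_cases hA : ∃ p, σ p ≠ 0 ∧ σ (p - (1, 0)) = 0
    · obtain ⟨p, hp, hl⟩ := hA
      have h1 : c (p - (1, 0), 2) + σ p ≠ 0 := by
        have := hfin (p - (1, 0))
        rwa [hl, sub_zero, sub_add_cancel] at this
      obtain ⟨u, hu, h2, h3⟩ : ∃ u, (σ (p + (1, 0)) = 0 → u = 0) ∧ c (p, 2) - σ p + u ≠ 0 ∧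
          c (p + (1, 0), 2) - u ≠ 0 := by
        by_cases hr : σ (p + (1, 0)) = 0
        · refine ⟨0, fun _ => rfl, ?_, by simpa using hc.2 _⟩
          have := hfin p
          rw [hr] at this
          intro h
          exact this (by linear_combination h)
        · have : ∀ a b : ZMod 3, ∃ u, a + u ≠ 0 ∧ b - u ≠ 0 := by decide
          obtain ⟨u, h2, h3⟩ := this (c (p, 2) - σ p) (c (p + (1, 0), 2))
          exact ⟨u, fun h => absurd h hr, h2, h3⟩
      obtain ⟨hrow, hmove⟩ := hc.add_pairBump hm p (σ p) u h1 h2 h3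
      refine step _ p hp (pairBump_left _ _ _ _) (fun x hx => ?_) hrow (.single hmove)
      by_contra h
      rcases eq_or_eq_of_pairBump_ne_zero h with ⟨rfl, -⟩ | ⟨rfl, h'⟩
      · exact hp hx
      · exact h (h'.trans (hu hx))
    · -- The support of `σ` is a union of rows. First `p + (1, 0)` is moved away from the final
      -- colour of `p`, then `p` is recoloured together with `p - (1, 0)`.
      push Not at hA
      obtain ⟨p, hp⟩ := h0
      have hA' : ∀ x, σ x ≠ 0 → σ (x + (1, 0)) ≠ 0 := fun x hx => by
        have := sub_closed_of_add_closed (U := fun x => σ x ≠ 0) (-(1, 0))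
          (fun x hx => by simpa only [← sub_eq_add_neg] using hA x hx) hx
        rwa [sub_neg_eq_add] at this
      obtain ⟨a, ha0, ha⟩ : ∃ a, c (p, 2) + a ≠ 0 ∧ c (p, 2) + a ≠ σ p := by
        have : ∀ a s : ZMod 3, ∃ t, a + t ≠ 0 ∧ a + t ≠ s := by decide
        exact this _ _
      obtain ⟨b, hb, hb'⟩ : ∃ b, c (p + (1, 0), 2) - a + b ≠ 0 ∧
          c (p + (1, 0) + (1, 0), 2) - b ≠ 0 := by
        have : ∀ a b : ZMod 3, ∃ u, a + u ≠ 0 ∧ b - u ≠ 0 := by decide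
        exact this _ _
      obtain ⟨hrow1, hmove1⟩ := hc.add_pairBump hm (p + (1, 0)) a b
        (by rwa [add_sub_cancel_right]) hb hb'
      set τ₁ := pairBump (p + (1, 0)) (p + (1, 0) + (1, 0)) a b with hτ₁
      have hne2 : p ≠ p + (1, 0) + (1, 0) := by
        rw [add_assoc]
        simpa [one_add_one_eq_two] using m2
      have hτp : τ₁ p = 0 := pairBump_of_ne (by simp [m1]) hne2 _ _
      set c₁ := c + coboundary τ₁ with hc₁
      have hp1 : c₁ (p, 2) = c (p, 2) + a := by
        rw [hc₁, Pi.add_apply, coboundary_two_dir, hτp, hτ₁, pairBump_left, sub_zero]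
      obtain ⟨d, hd, hd'⟩ : ∃ d, c₁ (p - (1, 0), 2) + σ p - d ≠ 0 ∧
          c₁ (p - (1, 0) - (1, 0), 2) + d ≠ 0 := by
        have : ∀ a b : ZMod 3, ∃ u, a - u ≠ 0 ∧ b + u ≠ 0 := by decide
        exact this _ _
      obtain ⟨hrow2, hmove2⟩ := hrow1.add_pairBump hm (p - (1, 0)) d (σ p) hd'
        (fun h => hd (by linear_combination h))
        (by rw [sub_add_cancel, hp1]; exact fun h => ha (sub_eq_zero.mp h))
      rw [sub_add_cancel] at hrow2 hmove2
      set τ₂ := pairBump (p - (1, 0)) p d (σ p) with hτ₂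
      have e : c₁ + coboundary τ₂ = c + coboundary (τ₁ + τ₂) := by
        rw [hc₁, add_assoc, ← coboundary_add]
      rw [e] at hrow2 hmove2
      refine step (τ₁ + τ₂) p hp ?_ (fun x hx => ?_) hrow2
        (.head hmove1 (.single hmove2))
      · rw [Pi.add_apply, hτp, zero_add, hτ₂, pairBump_right]
        intro h
        simpa [m1] using eq_sub_iff_add_eq.mp h
      · have h1 : τ₁ x = 0 := by
          by_contra h
          rcases eq_or_eq_of_pairBump_ne_zero h with ⟨rfl, -⟩ | ⟨rfl, -⟩
          · exact hA' _ hp hx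
          · exact hA' _ (hA' _ hp) hx
        have h2 : τ₂ x = 0 := by
          by_contra h
          rcases eq_or_eq_of_pairBump_ne_zero h with ⟨rfl, -⟩ | ⟨rfl, -⟩
          · exact hA _ hp hx
          · exact hp hx
        rw [Pi.add_apply, h1, h2, add_zero]

/-! ### Winding numbers -/

theorem eq_apply_zero_of_succ_eq {X : Type*} [NeZero n] {f : ZMod n → X}
    (h : ∀ i, f (i + 1) = f i) (i : ZMod n) : f i = f 0 := by
  have key : ∀ k : ℕ, f (k : ZMod n) = f 0 := fun k => by
    induction k with
    | zero => simp
    | succ k ih => rw [Nat.cast_succ, h, ih]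
  simpa using key i.val

theorem sum_row_eq_windingH [NeZero m] [NeZero n] {c : Config m n} (hc : Valid c) (j : ZMod n) :
    ∑ i : ZMod m, c ((i, j), 2) = windingH c :=
  eq_apply_zero_of_succ_eq (f := fun j => ∑ i : ZMod m, c ((i, j), 2)) (windingH_eq_succ c hc) j

theorem sum_column_eq_windingV [NeZero m] [NeZero n] {c : Config m n} (hc : Valid c)
    (i : ZMod m) : ∑ j : ZMod n, c ((i, j), 1) = windingV c :=
  eq_apply_zero_of_succ_eq (f := fun i => ∑ j : ZMod n, c ((i, j), 1)) (windingV_eq_succ c hc) i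

theorem fst_eq_of_mem_hexagon {p r : Site m n} (h : (r, 1) ∈ hexagon p) : r.1 = p.1 := by
  rcases mem_hexagon_one_dir.mp h with rfl | rfl <;> simp

theorem snd_eq_of_mem_hexagon {p r : Site m n} (h : (r, 2) ∈ hexagon p) : r.2 = p.2 := by
  rcases mem_hexagon_two_dir.mp h with rfl | rfl <;> simp

/-- A horizontal loop that avoids the two hexagons shows that a two-hexagon move preserves the
horizontal winding number. -/
theorem TwoHexagonMove.windingH_eq [NeZero m] [NeZero n] (hn : 3 ≤ n) {c c' : Config m n}
    (h : TwoHexagonMove c c') : windingH c = windingH c' := by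
  obtain ⟨hc, hc', p, d, h⟩ := h
  have n1 := zmod_one_ne_zero hn
  have n2 := zmod_two_ne_zero hn
  rw [← sum_row_eq_windingH hc (p.2 - 1), ← sum_row_eq_windingH hc' (p.2 - 1)]
  refine Finset.sum_congr rfl fun i _ => h _ fun hmem => ?_
  rcases Finset.mem_union.mp hmem with h' | h' <;> have := snd_eq_of_mem_hexagon h'
  · simp [n1] at this
  · have h2 : (-1 : ZMod n) = (direction (m := m) d).2 := by
      rw [Prod.snd_add, sub_eq_add_neg] at this
      exact add_left_cancel this
    have h3 : (-1 : ZMod n) ≠ 1 := fun h => n2 (by linear_combination -h)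
    fin_cases d <;> simp [direction, n1, h3] at h2

/-- A vertical loop that avoids the two hexagons shows that a two-hexagon move preserves the
vertical winding number. -/
theorem TwoHexagonMove.windingV_eq [NeZero m] [NeZero n] (hm : 3 ≤ m) {c c' : Config m n}
    (h : TwoHexagonMove c c') : windingV c = windingV c' := by
  obtain ⟨hc, hc', p, d, h⟩ := h
  have m1 := zmod_one_ne_zero hm
  have m2 := zmod_two_ne_zero hm
  obtain ⟨a, ha, had⟩ : ∃ a : ZMod m, a ≠ 0 ∧ a ≠ (direction (n := n) d).1 := by
    have h3 : (-1 : ZMod m) ≠ 1 := fun h => m2 (by linear_combination -h)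
    fin_cases d
    · exact ⟨-1, by simp [m1], by simpa [direction] using h3⟩
    · exact ⟨1, m1, by simpa [direction] using m1⟩
    · exact ⟨1, m1, by simpa [direction] using h3.symm⟩
  rw [← sum_column_eq_windingV hc (p.1 + a), ← sum_column_eq_windingV hc' (p.1 + a)]
  refine Finset.sum_congr rfl fun i _ => h _ fun hmem => ?_
  rcases Finset.mem_union.mp hmem with h' | h' <;> have := fst_eq_of_mem_hexagon h'
  · simp [ha] at this
  · rw [Prod.fst_add] at this
    exact had (add_left_cancel this)

/-- A function on a cycle with vanishing sum is the increment of a function on the cycle. -/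
theorem exists_increment_eq [NeZero n] (g : ZMod n → ZMod 3) (hg : ∑ i, g i = 0) :
    ∃ s : ZMod n → ZMod 3, ∀ i, s (i + 1) - s i = g i := by
  have hg' : ∑ k ∈ Finset.range n, g (k : ZMod n) = 0 := by
    rw [← hg]
    refine Finset.sum_nbij (fun k => (k : ZMod n)) (fun _ _ => Finset.mem_univ _) ?_ ?_
      fun _ _ => rfl
    · intro a ha b hb hab
      have := congrArg ZMod.val hab
      simpa [ZMod.val_natCast_of_lt (Finset.mem_range.mp ha),
        ZMod.val_natCast_of_lt (Finset.mem_range.mp hb)] using this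
    · intro i _
      exact ⟨i.val, by simpa using ZMod.val_lt i, by simp⟩
  refine ⟨fun i => ∑ k ∈ Finset.range i.val, g (k : ZMod n), fun i => ?_⟩
  have hsucc : ∑ k ∈ Finset.range (i.val + 1), g (k : ZMod n) =
      ∑ k ∈ Finset.range i.val, g (k : ZMod n) + g i := by
    rw [Finset.sum_range_succ, ZMod.natCast_zmod_val]
  have hi : i + 1 = ((i.val + 1 : ℕ) : ZMod n) := by simp
  rcases (Nat.succ_le_of_lt (ZMod.val_lt i)).lt_or_eq with h | h
  · dsimp only
    rw [hi, ZMod.val_natCast_of_lt h, hsucc]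
    ring
  · have h0 : i + 1 = 0 := by rw [hi, show i.val + 1 = n from h, ZMod.natCast_self]
    have h1 : i.val + 1 = n := h
    rw [h1, hg'] at hsucc
    dsimp only
    rw [h0, ZMod.val_zero, Finset.sum_range_zero]
    linear_combination hsucc

/-- On the torus, a configuration that obeys the Gauss law and has no winding comes from a
colouring. -/
theorem exists_eq_coboundary [NeZero m] [NeZero n] {D : Config m n} (hD : Gauss D)
    (hH : ∀ j, ∑ i : ZMod m, D ((i, j), 2) = 0) (hV : ∑ j : ZMod n, D ((0, j), 1) = 0) :
    ∃ σ, D = coboundary σ := by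
  choose s hs using fun j => exists_increment_eq _ (hH j)
  let γ : ZMod m → ZMod n → ZMod 3 := fun i j => -D ((i, j), 1) - (s (j + 1) i - s j i)
  have hγ : ∀ j i, γ i j = γ 0 j := fun j =>
    eq_apply_zero_of_succ_eq (f := fun i => γ i j) fun i => by
      have h1 := hD.1 (i, j)
      have h2 := hD.2 (i, j)
      have h3 := hs j i
      have h4 := hs (j + 1) i
      simp only [Prod.mk_add_mk, add_zero] at h2
      simp only [γ]
      linear_combination h1 - h2 + h3 - h4
  have hγ0 : ∑ j, γ 0 j = 0 := by
    have ht : ∑ j, s (j + 1) 0 = ∑ j, s j 0 :=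
      Equiv.sum_comp (Equiv.addRight (1 : ZMod n)) fun j => s j 0
    simp only [γ, Finset.sum_sub_distrib, Finset.sum_neg_distrib, hV, ht]
    ring
  obtain ⟨u, hu⟩ := exists_increment_eq _ hγ0
  have hone : ∀ i j, D ((i, j), 1) = s j i + u j - (s (j + 1) i + u (j + 1)) := fun i j => by
    have h1 := hu j
    rw [← hγ j i] at h1
    simp only [γ] at h1
    linear_combination h1
  have htwo : ∀ i j, D ((i, j), 2) = s j (i + 1) + u j - (s j i + u j) := fun i j => by
    linear_combination -hs j i
  refine ⟨fun p => s p.2 p.1 + u p.2, funext fun ⟨⟨i, j⟩, k⟩ => ?_⟩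
  fin_cases k
  · have h1 := hD.1 (i, j)
    simp only [Fin.zero_eta, coboundary_zero_dir, Prod.mk_add_mk, add_zero]
    linear_combination h1 - hone i j - htwo i j
  · simpa using hone i j
  · simpa using htwo i j

/-- Both configurations are brought to row-proper ones, which then differ by a recolouring. -/
theorem reachable_iff_winding_eq [NeZero m] [NeZero n] (hm : 3 ≤ m) (hn : 3 ≤ n)
    {c c' : Config m n} (hc : Valid c) (hc' : Valid c') :
    Relation.ReflTransGen TwoHexagonMove c c' ↔
      windingH c = windingH c' ∧ windingV c = windingV c' := by
  have forward : ∀ {c c' : Config m n}, Relation.ReflTransGen TwoHexagonMove c c' →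
      windingH c = windingH c' ∧ windingV c = windingV c' := fun h => by
    induction h with
    | refl => exact ⟨rfl, rfl⟩
    | tail _ h ih => exact ⟨ih.1.trans (h.windingH_eq hn), ih.2.trans (h.windingV_eq hm)⟩
  refine ⟨forward, fun h => ?_⟩
  obtain ⟨d, hd, hcd⟩ := exists_rowProper_reachable hm hn hc
  obtain ⟨d', hd', hcd'⟩ := exists_rowProper_reachable hm hn hc'
  have h1 := forward hcd
  have h2 := forward hcd'
  have hH : windingH d = windingH d' := by rw [← h1.1, h.1, h2.1]
  have hV : windingV d = windingV d' := by rw [← h1.2, h.2, h2.2]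
  obtain ⟨σ, hσ⟩ : ∃ σ, d' - d = coboundary σ := by
    refine exists_eq_coboundary (by rw [sub_eq_add_neg]; exact hd'.1.add hd.1.neg) (fun j => ?_) ?_
    · simp only [Pi.sub_apply, Finset.sum_sub_distrib, sum_row_eq_windingH hd.valid,
        sum_row_eq_windingH hd'.valid, hH, sub_self]
    · simp only [Pi.sub_apply, Finset.sum_sub_distrib, sum_column_eq_windingV hd.valid,
        sum_column_eq_windingV hd'.valid, hV, sub_self]
  have hdd : d' = d + coboundary σ := by rw [← hσ, add_sub_cancel]
  have : Std.Symm (TwoHexagonMove (m := m) (n := n)) := ⟨fun _ _ h => h.symm⟩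
  refine hcd.trans (.trans ?_ (Relation.ReflTransGen.stdSymm.symm _ _ hcd'))
  rw [hdd] at hd' ⊢
  exact hd.reachable_add_coboundary hm σ hd'

/-- Every pair of winding numbers occurs, for colourings `w i + v j` up to their twists. -/
theorem exists_valid_winding_eq [NeZero m] [NeZero n] (hm : 3 ≤ m) (a b : ZMod 3) :
    ∃ c : Config m n, Valid c ∧ windingH c = a ∧ windingV c = b := by
  obtain ⟨w, hw, hwa⟩ : ∃ w : ZMod m → ZMod 3, (∀ i, w i ≠ 0) ∧ ∑ i, w i = a := by
    have m1 := zmod_one_ne_zero hm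
    have : ∀ s : ZMod 3, ∃ x y : ZMod 3, x ≠ 0 ∧ y ≠ 0 ∧ x + y = s := by decide
    obtain ⟨x, y, hx, hy, hxy⟩ := this (a - ∑ i ∈ ({0, 1} : Finset (ZMod m))ᶜ, 1)
    refine ⟨fun i => if i = 0 then x else if i = 1 then y else 1, fun i => ?_, ?_⟩
    · dsimp only
      split_ifs <;> first | assumption | decide
    · rw [← Finset.sum_add_sum_compl {0, 1}, Finset.sum_pair m1.symm, if_pos rfl, if_neg m1,
        if_pos rfl, hxy, sub_add, sub_eq_self, sub_eq_zero]
      refine Finset.sum_congr rfl fun i hi => ?_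
      simp only [Finset.compl_insert, Finset.mem_erase, Finset.mem_compl,
        Finset.mem_singleton] at hi
      rw [if_neg hi.1, if_neg hi.2]
  let v : ZMod n → ZMod 3 := fun j => if j = 0 then b else 0
  let c : Config m n := fun e => ![-v e.1.2 - w e.1.1, v e.1.2, w e.1.1] e.2
  have hc : RowProper c := by
    refine ⟨⟨fun p => ?_, fun p => ?_⟩, fun p => hw p.1⟩
    · simp only [c, Matrix.cons_val]
      ring
    · simp only [c, Matrix.cons_val, Prod.fst_add, Prod.snd_add, add_zero]
      ring
  refine ⟨c, hc.valid, hwa, ?_⟩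
  simp [windingV, c, v]

/-! ### The edge sets of the terms -/

theorem card_vertexStar (v : Vertex m n) : (vertexStar v).card = 3 := by
  rcases v with p | p
  · exact Finset.card_eq_three.mpr ⟨_, _, _, by simp, by simp, by simp, rfl⟩
  · exact Finset.card_eq_three.mpr ⟨_, _, _, by simp, by simp, by simp, rfl⟩

theorem card_hexagon (hm : 3 ≤ m) (hn : 3 ≤ n) (p : Site m n) : (hexagon p).card = 6 := by
  have m1 := zmod_one_ne_zero hm
  have n1 := zmod_one_ne_zero hn
  rw [hexagon, Finset.card_insert_of_notMem, Finset.card_insert_of_notMem,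
    Finset.card_insert_of_notMem, Finset.card_insert_of_notMem, Finset.card_insert_of_notMem,
    Finset.card_singleton]
  all_goals simp [m1, n1, eq_sub_iff_add_eq, sub_eq_iff_eq_add, sub_add_eq_add_sub]

/-- Two adjacent hexagons share exactly one edge. -/
theorem hexagon_inter_hexagon (hm : 3 ≤ m) (hn : 3 ≤ n) (p : Site m n) (d : Fin 3) :
    ∃ e, hexagon p ∩ hexagon (p + direction d) = {e} := by
  have m1 := zmod_one_ne_zero hm
  have n1 := zmod_one_ne_zero hn
  have m2 : (1 : ZMod m) + 1 ≠ 0 := by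
    rw [one_add_one_eq_two]; exact zmod_two_ne_zero hm
  have n2 : (1 : ZMod n) + 1 ≠ 0 := by
    rw [one_add_one_eq_two]; exact zmod_two_ne_zero hn
  refine ⟨![(p, 2), (p, 1), (p - (1, 0), 0)] d, Finset.Subset.antisymm ?_ ?_⟩
  · rintro ⟨r, k⟩ h
    rw [Finset.mem_inter] at h
    rw [Finset.mem_singleton]
    obtain ⟨h1, h2⟩ := h
    fin_cases k
    · rcases mem_hexagon_zero_dir.mp h1 with rfl | rfl <;>
      rcases mem_hexagon_zero_dir.mp h2 with h2 | h2 <;>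
      fin_cases d <;>
      simp [direction, add_assoc, m1, n1, m2, n2, neg_eq_iff_add_eq_zero] at h2 ⊢
    · rcases mem_hexagon_one_dir.mp h1 with rfl | rfl <;>
      rcases mem_hexagon_one_dir.mp h2 with h2 | h2 <;>
      fin_cases d <;>
      simp [direction, add_assoc, m1, n1, n2, neg_eq_iff_add_eq_zero] at h2 ⊢
    · rcases mem_hexagon_two_dir.mp h1 with rfl | rfl <;>
      rcases mem_hexagon_two_dir.mp h2 with h2 | h2 <;>
      fin_cases d <;>
      simp [direction, add_assoc, m1, n1, m2, neg_eq_iff_add_eq_zero] at h2 ⊢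
  · rw [Finset.singleton_subset_iff, Finset.mem_inter]
    fin_cases d
    · exact ⟨mem_hexagon_two_dir.mpr (.inl rfl), mem_hexagon_two_dir.mpr (.inr rfl)⟩
    · exact ⟨mem_hexagon_one_dir.mpr (.inl rfl), mem_hexagon_one_dir.mpr (.inr rfl)⟩
    · refine ⟨mem_hexagon_zero_dir.mpr (.inr (by simp)), mem_hexagon_zero_dir.mpr (.inl ?_)⟩
      ext <;> simp [direction, sub_eq_add_neg]

theorem card_twoHexagon (hm : 3 ≤ m) (hn : 3 ≤ n) (p : Site m n) (d : Fin 3) :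
    (twoHexagon p d).card = 11 := by
  obtain ⟨e, he⟩ := hexagon_inter_hexagon hm hn p d
  rw [twoHexagon, Finset.card_union, he, card_hexagon hm hn, card_hexagon hm hn,
    Finset.card_singleton]

/-- A vertex of one of two hexagons has at most one edge that belongs to neither. -/
theorem exists_vertexStar_subset_insert {v : Vertex m n} {p : Site m n} {d : Fin 3}
    (h : (vertexStar v ∩ twoHexagon p d).Nonempty) :
    ∃ e₀, vertexStar v ⊆ insert e₀ (twoHexagon p d) := by
  have key : ∀ q, (vertexStar v ∩ hexagon q).Nonempty →
      ∃ e₀, vertexStar v ⊆ insert e₀ (hexagon q) := by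
    rintro q ⟨e, he⟩
    obtain ⟨h1, h2⟩ := Finset.mem_inter.mp he
    rcases v with r | r
    · have hq : q = r ∨ q = r + (0, 1) ∨ q = r + (1, 0) := by
        simp only [vertexStar, Finset.mem_insert, Finset.mem_singleton] at h1
        rcases h1 with rfl | rfl | rfl
        · exact .inr (mem_hexagon_zero_dir.mp h2)
        · exact (mem_hexagon_one_dir.mp h2).imp_right .inl
        · exact (mem_hexagon_two_dir.mp h2).imp_right .inr
      have h0 := mem_hexagon_zero_dir (q := q) (r := r)
      have h1 := mem_hexagon_one_dir (q := q) (r := r)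
      have h2 := mem_hexagon_two_dir (q := q) (r := r)
      simp only [vertexStar, Finset.insert_subset_iff, Finset.singleton_subset_iff,
        Finset.mem_insert]
      rcases hq with hq | hq | hq
      · exact ⟨_, .inl rfl, .inr (h1.mpr (.inl hq)), .inr (h2.mpr (.inl hq))⟩
      · exact ⟨_, .inr (h0.mpr (.inl hq)), .inr (h1.mpr (.inr hq)), .inl rfl⟩
      · exact ⟨_, .inr (h0.mpr (.inr hq)), .inl rfl, .inr (h2.mpr (.inr hq))⟩
    · have e1 : r + (1, 0) + (0, 1) = r + (0, 1) + (1, 0) := add_right_comm _ _ _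
      have h0 := mem_hexagon_zero_dir (q := q) (r := r)
      have h1' := mem_hexagon_one_dir (q := q) (r := r + (1, 0))
      have h2' := mem_hexagon_two_dir (q := q) (r := r + (0, 1))
      rw [e1] at h1'
      have hq : q = r + (0, 1) ∨ q = r + (1, 0) ∨ q = r + (0, 1) + (1, 0) := by
        simp only [vertexStar, Finset.mem_insert, Finset.mem_singleton] at h1
        rcases h1 with rfl | rfl | rfl
        · exact (h0.mp h2).imp_right .inl
        · exact .inr (h1'.mp h2)
        · exact (h2'.mp h2).imp_right .inr
      simp only [vertexStar, Finset.insert_subset_iff, Finset.singleton_subset_iff,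
        Finset.mem_insert]
      rcases hq with hq | hq | hq
      · exact ⟨_, .inr (h0.mpr (.inl hq)), .inl rfl, .inr (h2'.mpr (.inl hq))⟩
      · exact ⟨_, .inr (h0.mpr (.inr hq)), .inr (h1'.mpr (.inl hq)), .inl rfl⟩
      · exact ⟨_, .inl rfl, .inr (h1'.mpr (.inr hq)), .inr (h2'.mpr (.inr hq))⟩
  rw [twoHexagon, Finset.inter_union_distrib_left, Finset.union_nonempty] at h
  rcases h with h | h <;> obtain ⟨e₀, he₀⟩ := key _ h <;>
    refine ⟨e₀, he₀.trans (Finset.insert_subset_insert _ ?_)⟩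
  · exact Finset.subset_union_left
  · exact Finset.subset_union_right

/-! ### Extending a local projector -/

section Extension

variable (R : Finset (Edge m n))

theorem glue_glue (x y : LocalConfig R) (c : Config m n) :
    glue R y (glue R x c) = glue R y c := by
  ext e
  by_cases he : e ∈ R <;> simp [glue, he]

theorem glue_restrict (c : Config m n) : glue R (fun e => c e) c = c := by
  ext e
  simp [glue]

theorem glue_apply_mem (x : LocalConfig R) (c : Config m n) (e : R) : glue R x c e = x e := by
  simp [glue]

theorem glue_apply_of_notMem (x : LocalConfig R) (c : Config m n) {e : Edge m n} (he : e ∉ R) :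
    glue R x c e = c e := by
  simp [glue, he]

theorem glue_eq_of_eq_off {c c' : Config m n} (h : ∀ e ∉ R, c e = c' e) :
    glue R (fun e => c' e) c = c' := by
  ext e
  by_cases he : e ∈ R <;> simp [glue, he, h]

variable [NeZero m] [NeZero n]

/-- The state of the edges in `R` obtained from `ψ` by fixing the other edges as in `c`. -/
def slice (ψ : HilbertSpace m n) (c : Config m n) : LocalSpace R :=
  WithLp.toLp 2 fun x => ψ (glue R x c)

theorem slice_apply (ψ : HilbertSpace m n) (c : Config m n) (x : LocalConfig R) :
    slice R ψ c x = ψ (glue R x c) := rfl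

theorem extendOp_apply (h : Module.End ℂ (LocalSpace R)) (ψ : HilbertSpace m n)
    (c : Config m n) : extendOp R h ψ c = h (slice R ψ c) fun e => c e := rfl

theorem slice_extendOp (h : Module.End ℂ (LocalSpace R)) (ψ : HilbertSpace m n)
    (c : Config m n) : slice R (extendOp R h ψ) c = h (slice R ψ c) := by
  ext x
  rw [slice_apply, extendOp_apply]
  have h1 : slice R ψ (glue R x c) = slice R ψ c := by
    ext y
    rw [slice_apply, slice_apply, glue_glue]
  rw [h1, show (fun e : R => glue R x c e) = x from funext (glue_apply_mem R x c)]

/-- Summing over all configurations after resampling the edges in `R` counts every configuration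
equally often. -/
theorem sum_sum_glue {M : Type*} [AddCommMonoid M] (F : Config m n → M) :
    ∑ c : Config m n, ∑ x : LocalConfig R, F (glue R x c) =
      Fintype.card (LocalConfig R) • ∑ c, F c := by
  let σ : Config m n × LocalConfig R → Config m n × LocalConfig R :=
    fun q => (glue R q.2 q.1, fun e => q.1 e)
  have hσ : Function.Involutive σ := by
    rintro ⟨c, x⟩
    simp only [σ, Prod.mk.injEq]
    exact ⟨by rw [glue_glue, glue_restrict], funext fun e => glue_apply_mem R x c e⟩
  calc ∑ c : Config m n, ∑ x : LocalConfig R, F (glue R x c)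
      = ∑ q : Config m n × LocalConfig R, F (σ q).1 := (Fintype.sum_prod_type' _).symm
    _ = ∑ q : Config m n × LocalConfig R, F q.1 :=
        Equiv.sum_comp hσ.toPerm fun q => F q.1
    _ = _ := by simp [Fintype.sum_prod_type, Finset.smul_sum]

theorem sum_inner_slice (ψ φ : HilbertSpace m n) :
    ∑ c, inner ℂ (slice R ψ c) (slice R φ c) =
      Fintype.card (LocalConfig R) • inner ℂ ψ φ := by
  simp only [PiLp.inner_apply, slice_apply]
  exact sum_sum_glue R fun c => inner ℂ (ψ c) (φ c)

theorem eq_zero_of_slice_eq_zero {ψ : HilbertSpace m n} (h : ∀ c, slice R ψ c = 0) : ψ = 0 := by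
  ext c
  have := congrArg (fun u : LocalSpace R => u fun e => c e) (h c)
  simpa [slice_apply, glue_restrict] using this

theorem isSymmetricProjection_extendOp {h : Module.End ℂ (LocalSpace R)}
    (hh : h.IsSymmetricProjection) : (extendOp R h).IsSymmetricProjection := by
  constructor
  · ext1 ψ
    refine sub_eq_zero.mp (eq_zero_of_slice_eq_zero R fun c => ?_)
    have h1 : slice R ((extendOp R h * extendOp R h) ψ) c = slice R (extendOp R h ψ) c := by
      rw [Module.End.mul_apply, slice_extendOp, slice_extendOp]
      exact LinearMap.congr_fun hh.isIdempotentElem _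
    exact sub_eq_zero.mpr h1
  · intro ψ φ
    have h1 := sum_inner_slice R (extendOp R h ψ) φ
    have h2 := sum_inner_slice R ψ (extendOp R h φ)
    simp only [slice_extendOp] at h1 h2
    have h3 : Fintype.card (LocalConfig R) • inner ℂ (extendOp R h ψ) φ =
        Fintype.card (LocalConfig R) • inner ℂ ψ (extendOp R h φ) := by
      rw [← h1, ← h2]
      exact Finset.sum_congr rfl fun c _ => hh.isSymmetric _ _
    exact smul_right_injective ℂ Fintype.card_ne_zero h3

/-- The extended projector annihilates `ψ` if and only if all slices of `ψ` lie in the kernel of the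
local projector. -/
theorem extendOp_starProjection_eq_zero_iff (K : Submodule ℂ (LocalSpace R))
    (ψ : HilbertSpace m n) :
    extendOp R (Kᗮ.starProjection : LocalSpace R →ₗ[ℂ] _) ψ = 0 ↔ ∀ c, slice R ψ c ∈ K := by
  have key : ∀ c, slice R (extendOp R (Kᗮ.starProjection : LocalSpace R →ₗ[ℂ] _) ψ) c = 0 ↔
      slice R ψ c ∈ K := fun c => by
    rw [slice_extendOp, ContinuousLinearMap.coe_coe, Submodule.starProjection_apply_eq_zero_iff,
      Submodule.orthogonal_orthogonal]
  refine ⟨fun h c => (key c).mp ?_, fun h => eq_zero_of_slice_eq_zero R fun c => (key c).mpr (h c)⟩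
  rw [h]
  rfl

end Extension

/-! ### States annihilated by all terms -/

theorem allowedAt_congr {v : Vertex m n} {c c' : Config m n} (h : ∀ e ∈ vertexStar v, c e = c' e) :
    AllowedAt v c ↔ AllowedAt v c' := by
  unfold AllowedAt
  rw [Finset.sum_congr rfl h]
  refine and_congr_right fun _ => exists_congr fun e => and_congr_right fun he => ?_
  rw [h e he]

theorem foldedAt_congr {v : Vertex m n} {c c' : Config m n} (h : ∀ e ∈ vertexStar v, c e = c' e) :
    FoldedAt v c ↔ FoldedAt v c' := by
  rcases v with p | p <;> exact forall₂_congr fun e he => by rw [h e he]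

theorem mem_vertexGroundSpace_iff {v : Vertex m n} {u : LocalSpace (vertexStar v)} :
    u ∈ vertexGroundSpace v ↔
      ∀ x : LocalConfig (vertexStar v), ¬ (∑ e, x e = 0 ∧ ∃ e, x e ≠ 0) → u x = 0 := by
  constructor
  · intro hu x hx
    refine Submodule.span_induction (p := fun u _ => u x = 0) ?_ ?_ ?_ ?_ hu
    · rintro _ ⟨y, hy, rfl⟩
      rw [PiLp.single_apply, if_neg]
      rintro rfl
      exact hx hy
    · rfl
    · intro a b _ _ ha hb
      rw [PiLp.add_apply, ha, hb, add_zero]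
    · intro a b _ hb
      rw [PiLp.smul_apply, hb, smul_zero]
  · intro hu
    have h1 : u = ∑ x, u x • EuclideanSpace.single x (1 : ℂ) := by
      ext y
      simp [Pi.single_apply]
    rw [h1]
    refine Submodule.sum_mem _ fun x _ => ?_
    by_cases hx : ∑ e, x e = 0 ∧ ∃ e, x e ≠ 0
    · exact Submodule.smul_mem _ _ (Submodule.subset_span ⟨x, hx, rfl⟩)
    · rw [hu x hx, zero_smul]
      exact Submodule.zero_mem _

theorem allowedAt_glue_iff (v : Vertex m n) (x : LocalConfig (vertexStar v)) (c : Config m n) :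
    AllowedAt v (glue (vertexStar v) x c) ↔ ∑ e, x e = 0 ∧ ∃ e, x e ≠ 0 := by
  unfold AllowedAt
  rw [← Finset.sum_coe_sort]
  simp only [glue_apply_mem]
  refine and_congr_right fun _ => ⟨?_, ?_⟩
  · rintro ⟨e, he, h⟩
    exact ⟨⟨e, he⟩, by rwa [glue_apply_mem _ x c ⟨e, he⟩] at h⟩
  · rintro ⟨e, h⟩
    exact ⟨e, e.2, by rwa [glue_apply_mem]⟩

theorem vertexTerm_eq_zero_iff [NeZero m] [NeZero n] (v : Vertex m n) (ψ : HilbertSpace m n) :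
    vertexTerm v ψ = 0 ↔ ∀ c, ¬ AllowedAt v c → ψ c = 0 := by
  rw [vertexTerm, extendOp_starProjection_eq_zero_iff]
  simp only [mem_vertexGroundSpace_iff, slice_apply]
  constructor
  · intro h c hc
    have := h c (fun e => c e)
    rw [← allowedAt_glue_iff v _ c, glue_restrict] at this
    exact this hc
  · intro h c x hx
    exact h _ (by rwa [allowedAt_glue_iff])

/-- The configuration `x` on `R`, surrounded by `s`, is allowed at all vertices that touch `R`. -/
def AllowedNear (R : Finset (Edge m n)) (x : LocalConfig R) (s : Config m n) : Prop :=
  ∀ v : Vertex m n, (vertexStar v ∩ R).Nonempty → AllowedAt v (glue R x s)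

open Classical in
/-- The number of folded trimers at the vertices that touch `R`. -/
def foldedNear [NeZero m] [NeZero n] (R : Finset (Edge m n)) (c : Config m n) : ℕ :=
  (Finset.univ.filter fun v : Vertex m n => (vertexStar v ∩ R).Nonempty ∧ FoldedAt v c).card

open Classical in
/-- The number of folded trimers at the vertices that do not touch `R`. -/
def foldedAway [NeZero m] [NeZero n] (R : Finset (Edge m n)) (c : Config m n) : ℕ :=
  (Finset.univ.filter fun v : Vertex m n => ¬ (vertexStar v ∩ R).Nonempty ∧ FoldedAt v c).card

theorem foldedNear_add_foldedAway [NeZero m] [NeZero n] (R : Finset (Edge m n))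
    (c : Config m n) : foldedNear R c + foldedAway R c = foldedCount c := by
  classical
  unfold foldedNear foldedAway foldedCount
  rw [← Finset.card_filter_add_card_filter_not (s := Finset.univ.filter fun v => FoldedAt v c)
    fun v => (vertexStar v ∩ R).Nonempty]
  simp only [Finset.filter_filter]
  congr 2 <;> ext v <;> simp [and_comm]

theorem eq_on_vertexStar_of_eq_off {R : Finset (Edge m n)} {c c' : Config m n} {v : Vertex m n}
    (h : ∀ e ∉ R, c e = c' e) (hv : ¬ (vertexStar v ∩ R).Nonempty) :
    ∀ e ∈ vertexStar v, c e = c' e :=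
  fun e he => h e fun heR => hv ⟨e, Finset.mem_inter.mpr ⟨he, heR⟩⟩

theorem foldedAway_congr [NeZero m] [NeZero n] {R : Finset (Edge m n)} {c c' : Config m n}
    (h : ∀ e ∉ R, c e = c' e) : foldedAway R c = foldedAway R c' := by
  classical
  unfold foldedAway
  congr 1
  ext v
  rw [Finset.mem_filter_univ, Finset.mem_filter_univ]
  exact and_congr_right fun hv => foldedAt_congr (eq_on_vertexStar_of_eq_off h hv)

theorem boundaryState_apply [NeZero m] [NeZero n] (R : Finset (Edge m n)) (ζ : ℂ)
    (s : Config m n) (x : LocalConfig R) [Decidable (AllowedNear R x s)] :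
    boundaryState R ζ s x = if AllowedNear R x s then ζ ^ foldedNear R (glue R x s) else 0 := by
  by_cases h : AllowedNear R x s
  · rw [if_pos h]
    exact if_pos h
  · rw [if_neg h]
    exact if_neg h

/-- If a configuration of two hexagons is allowed in two surroundings, then the surroundings agree
at all touching vertices, because the Gauss law determines the one outer edge of such a vertex. -/
theorem surroundings_eq {p : Site m n} {d : Fin 3} {x : LocalConfig (twoHexagon p d)}
    {s s' : Config m n} (h : AllowedNear _ x s) (h' : AllowedNear _ x s') {v : Vertex m n}
    (hv : (vertexStar v ∩ twoHexagon p d).Nonempty) {e : Edge m n} (he : e ∈ vertexStar v)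
    (heR : e ∉ twoHexagon p d) : s e = s' e := by
  obtain ⟨e₀, he₀⟩ := exists_vertexStar_subset_insert hv
  have hin : ∀ e' ∈ vertexStar v, e' ≠ e → e' ∈ twoHexagon p d := by
    intro e' he' hne
    have h1 : e = e₀ := (Finset.mem_insert.mp (he₀ he)).resolve_right heR
    exact (Finset.mem_insert.mp (he₀ he')).resolve_left fun h2 => hne (h2.trans h1.symm)
  have hs := (h v hv).1
  have hs' := (h' v hv).1
  rw [← Finset.add_sum_erase _ _ he, glue_apply_of_notMem _ _ _ heR] at hs hs'
  have hrest : ∑ e' ∈ (vertexStar v).erase e, glue (twoHexagon p d) x s e' =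
      ∑ e' ∈ (vertexStar v).erase e, glue (twoHexagon p d) x s' e' := by
    refine Finset.sum_congr rfl fun e' he' => ?_
    have h1 := hin e' (Finset.mem_of_mem_erase he') (Finset.ne_of_mem_erase he')
    exact (glue_apply_mem _ x s ⟨e', h1⟩).trans (glue_apply_mem _ x s' ⟨e', h1⟩).symm
  rw [hrest] at hs
  exact add_right_cancel (hs.trans hs'.symm)

theorem glue_eq_on_vertexStar {p : Site m n} {d : Fin 3} {x : LocalConfig (twoHexagon p d)}
    {s s' : Config m n} (h : AllowedNear _ x s) (h' : AllowedNear _ x s')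
    (y : LocalConfig (twoHexagon p d)) {v : Vertex m n}
    (hv : (vertexStar v ∩ twoHexagon p d).Nonempty) :
    ∀ e ∈ vertexStar v, glue _ y s e = glue _ y s' e := by
  intro e he
  by_cases heR : e ∈ twoHexagon p d
  · exact (glue_apply_mem _ y s ⟨e, heR⟩).trans (glue_apply_mem _ y s' ⟨e, heR⟩).symm
  · rw [glue_apply_of_notMem _ _ _ heR, glue_apply_of_notMem _ _ _ heR,
      surroundings_eq h h' hv he heR]

theorem foldedNear_glue_congr [NeZero m] [NeZero n] {p : Site m n} {d : Fin 3}
    {x : LocalConfig (twoHexagon p d)} {s s' : Config m n} (h : AllowedNear _ x s)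
    (h' : AllowedNear _ x s') (y : LocalConfig (twoHexagon p d)) :
    foldedNear (twoHexagon p d) (glue _ y s) = foldedNear (twoHexagon p d) (glue _ y s') := by
  classical
  unfold foldedNear
  congr 1
  ext v
  rw [Finset.mem_filter_univ, Finset.mem_filter_univ]
  exact and_congr_right fun hv => foldedAt_congr (glue_eq_on_vertexStar h h' y hv)

theorem AllowedNear.congr {p : Site m n} {d : Fin 3}
    {x : LocalConfig (twoHexagon p d)} {s s' : Config m n} (h : AllowedNear _ x s)
    (h' : AllowedNear _ x s') {y : LocalConfig (twoHexagon p d)} (hy : AllowedNear _ y s) :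
    AllowedNear _ y s' :=
  fun v hv => (allowedAt_congr (glue_eq_on_vertexStar h h' y hv)).mp (hy v hv)

/-- On the span of the boundary states, the amplitudes of two configurations that are allowed in the
same surroundings have the ratio prescribed by their folded trimers. -/
theorem amplitude_eq_of_mem_span [NeZero m] [NeZero n] {ζ : ℂ} {p : Site m n} {d : Fin 3}
    {u : LocalSpace (twoHexagon p d)}
    (hu : u ∈ Submodule.span ℂ (Set.range (boundaryState (twoHexagon p d) ζ)))
    {s : Config m n} {x y : LocalConfig (twoHexagon p d)}
    (hx : AllowedNear _ x s) (hy : AllowedNear _ y s) :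
    u x * ζ ^ foldedNear (twoHexagon p d) (glue _ y s) =
      u y * ζ ^ foldedNear (twoHexagon p d) (glue _ x s) := by
  classical
  refine Submodule.span_induction (p := fun u _ =>
    u x * ζ ^ foldedNear (twoHexagon p d) (glue _ y s) =
      u y * ζ ^ foldedNear (twoHexagon p d) (glue _ x s)) ?_ ?_ ?_ ?_ hu
  · rintro _ ⟨s', rfl⟩
    rw [boundaryState_apply, boundaryState_apply]
    by_cases h : AllowedNear _ x s'
    · rw [if_pos h, if_pos (hx.congr h hy), foldedNear_glue_congr hx h x,
        foldedNear_glue_congr hx h y, mul_comm]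
    · rw [if_neg h, if_neg fun h' => h (hy.congr h' hx), zero_mul, zero_mul]
  · simp
  · intro a b _ _ ha hb
    rw [PiLp.add_apply, PiLp.add_apply, add_mul, add_mul, ha, hb]
  · intro a b _ hb
    rw [PiLp.smul_apply, PiLp.smul_apply, smul_eq_mul, smul_eq_mul, mul_assoc, mul_assoc, hb]

/-- The states that are supported on valid configurations and whose amplitudes, divided by the
trimer weights, are invariant under two-hexagon moves. -/
def MoveInvariant [NeZero m] [NeZero n] (ζ : ℂ) (ψ : HilbertSpace m n) : Prop :=
  (∀ c, ¬ Valid c → ψ c = 0) ∧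
    ∀ c c', TwoHexagonMove c c' → ψ c * ζ ^ foldedCount c' = ψ c' * ζ ^ foldedCount c

theorem moveInvariant_of_terms_eq_zero [NeZero m] [NeZero n] {ζ : ℂ} {ψ : HilbertSpace m n}
    (hv : ∀ v : Vertex m n, vertexTerm v ψ = 0)
    (hp : ∀ (p : Site m n) (d : Fin 3), twoHexagonTerm ζ p d ψ = 0) : MoveInvariant ζ ψ := by
  constructor
  · intro c hc
    rw [Valid, not_forall] at hc
    obtain ⟨v, hc⟩ := hc
    exact (vertexTerm_eq_zero_iff v ψ).mp (hv v) c hc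
  · rintro c c' ⟨hc, hc', p, d, hcc'⟩
    have hspan := (extendOp_starProjection_eq_zero_iff _ _ ψ).mp (hp p d) c
    have e1 := glue_restrict (twoHexagon p d) c
    have e2 := glue_eq_of_eq_off (twoHexagon p d) hcc'
    have := amplitude_eq_of_mem_span hspan (s := c) (x := fun e => c e) (y := fun e => c' e)
      (fun v _ => by rw [e1]; exact hc v) (fun v _ => by rw [e2]; exact hc' v)
    rw [slice_apply, slice_apply, e1, e2] at this
    rw [← foldedNear_add_foldedAway (twoHexagon p d) c,
      ← foldedNear_add_foldedAway (twoHexagon p d) c', foldedAway_congr hcc', pow_add, pow_add,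
      ← mul_assoc, ← mul_assoc, this]

theorem terms_eq_zero_of_moveInvariant [NeZero m] [NeZero n] {ζ : ℂ} (hζ : ζ ≠ 0)
    {ψ : HilbertSpace m n} (h : MoveInvariant ζ ψ) :
    (∀ v : Vertex m n, vertexTerm v ψ = 0) ∧
      ∀ (p : Site m n) (d : Fin 3), twoHexagonTerm ζ p d ψ = 0 := by
  classical
  refine ⟨fun v => (vertexTerm_eq_zero_iff v ψ).mpr fun c hc => h.1 c fun h' => hc (h' v),
    fun p d => (extendOp_starProjection_eq_zero_iff _ _ ψ).mpr fun c => ?_⟩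
  by_cases hex : ∃ x, Valid (glue (twoHexagon p d) x c)
  · -- The slice is a multiple of the boundary state for `c`.
    obtain ⟨x₀, h₀⟩ := hex
    set c₀ := glue (twoHexagon p d) x₀ c with hc₀
    have hoff : ∀ x, ∀ e ∉ twoHexagon p d, c₀ e = glue (twoHexagon p d) x c e := fun x e he => by
      rw [hc₀, glue_apply_of_notMem _ _ _ he, glue_apply_of_notMem _ _ _ he]
    have hslice : slice (twoHexagon p d) ψ c =
        (ψ c₀ / ζ ^ foldedNear (twoHexagon p d) c₀) • boundaryState (twoHexagon p d) ζ c := by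
      ext x
      rw [PiLp.smul_apply, boundaryState_apply, slice_apply, smul_eq_mul]
      by_cases hx : AllowedNear (twoHexagon p d) x c
      · have hval : Valid (glue (twoHexagon p d) x c) := fun v => by
          by_cases hv : (vertexStar v ∩ twoHexagon p d).Nonempty
          · exact hx v hv
          · exact (allowedAt_congr (eq_on_vertexStar_of_eq_off (hoff x) hv)).mp (h₀ v)
        have := h.2 _ _ ⟨h₀, hval, p, d, hoff x⟩
        rw [← foldedNear_add_foldedAway (twoHexagon p d) c₀,
          ← foldedNear_add_foldedAway (twoHexagon p d) (glue (twoHexagon p d) x c),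
          foldedAway_congr (hoff x), pow_add, pow_add, ← mul_assoc, ← mul_assoc] at this
        have := mul_right_cancel₀ (pow_ne_zero _ hζ) this
        rw [if_pos hx, div_mul_eq_mul_div, this, mul_div_cancel_right₀ _ (pow_ne_zero _ hζ)]
      · rw [if_neg hx, mul_zero]
        exact h.1 _ fun hval => hx fun v _ => hval v
    rw [hslice]
    exact Submodule.smul_mem _ _ (Submodule.subset_span ⟨c, rfl⟩)
  · have hslice : slice (twoHexagon p d) ψ c = 0 := by
      ext x
      exact h.1 _ fun hval => hex ⟨x, hval⟩
    rw [hslice]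
    exact Submodule.zero_mem _

/-! ### The ground space -/

theorem isSymmetricProjection_vertexTerm [NeZero m] [NeZero n] (v : Vertex m n) :
    (vertexTerm v).IsSymmetricProjection :=
  isSymmetricProjection_extendOp _ (Submodule.isSymmetricProjection_starProjection _)

theorem isSymmetricProjection_twoHexagonTerm [NeZero m] [NeZero n] (ζ : ℂ) (p : Site m n)
    (d : Fin 3) : (twoHexagonTerm ζ p d).IsSymmetricProjection :=
  isSymmetricProjection_extendOp _ (Submodule.isSymmetricProjection_starProjection _)

theorem isPositive_hamiltonian [NeZero m] [NeZero n] (ζ : ℂ) :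
    (hamiltonian m n ζ).IsPositive :=
  (LinearMap.isPositive_sum _ fun v _ => (isSymmetricProjection_vertexTerm v).isPositive).add
    (LinearMap.isPositive_sum _ fun p _ => LinearMap.isPositive_sum _ fun d _ =>
      (isSymmetricProjection_twoHexagonTerm ζ p d).isPositive)

theorem re_inner_apply_self_eq {E : Type*} [NormedAddCommGroup E] [InnerProductSpace ℂ E]
    {T : Module.End ℂ E} (hT : T.IsSymmetricProjection) (x : E) :
    (inner ℂ (T x) x).re = ‖T x‖ ^ 2 := by
  have h1 : T (T x) = T x := LinearMap.congr_fun hT.isIdempotentElem x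
  rw [← h1, hT.isSymmetric, h1]
  exact inner_self_eq_norm_sq (𝕜 := ℂ) _

/-- Frustration-freeness: a zero-energy state of a sum of projectors is annihilated by each. -/
theorem terms_eq_zero_of_hamiltonian_eq_zero [NeZero m] [NeZero n] {ζ : ℂ}
    {ψ : HilbertSpace m n} (h : hamiltonian m n ζ ψ = 0) :
    (∀ v : Vertex m n, vertexTerm v ψ = 0) ∧
      ∀ (p : Site m n) (d : Fin 3), twoHexagonTerm ζ p d ψ = 0 := by
  have h1 : ∑ v : Vertex m n, ‖vertexTerm v ψ‖ ^ 2 +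
      ∑ p : Site m n, ∑ d : Fin 3, ‖twoHexagonTerm ζ p d ψ‖ ^ 2 = 0 := by
    have : (inner ℂ (hamiltonian m n ζ ψ) ψ).re = 0 := by rw [h, inner_zero_left, Complex.zero_re]
    have hv := fun v : Vertex m n => re_inner_apply_self_eq (isSymmetricProjection_vertexTerm v) ψ
    have hp := fun (p : Site m n) (d : Fin 3) =>
      re_inner_apply_self_eq (isSymmetricProjection_twoHexagonTerm ζ p d) ψ
    simpa only [hamiltonian, LinearMap.add_apply, LinearMap.sum_apply, inner_add_left, sum_inner,
      Complex.add_re, Complex.re_sum, hv, hp] using this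
  have hA : 0 ≤ ∑ v : Vertex m n, ‖vertexTerm v ψ‖ ^ 2 := by positivity
  have hB : 0 ≤ ∑ p : Site m n, ∑ d : Fin 3, ‖twoHexagonTerm ζ p d ψ‖ ^ 2 := by positivity
  obtain ⟨h2, h3⟩ := (add_eq_zero_iff_of_nonneg hA hB).mp h1
  constructor
  · intro v
    have := (Finset.sum_eq_zero_iff_of_nonneg fun v _ => by positivity).mp h2 v (Finset.mem_univ v)
    simpa using this
  · intro p d
    have h4 := (Finset.sum_eq_zero_iff_of_nonneg fun p _ => by positivity).mp h3 p
      (Finset.mem_univ p)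
    have := (Finset.sum_eq_zero_iff_of_nonneg fun d _ => by positivity).mp h4 d (Finset.mem_univ d)
    simpa using this

theorem hamiltonian_eq_zero_iff [NeZero m] [NeZero n] {ζ : ℂ} (hζ : ζ ≠ 0)
    (ψ : HilbertSpace m n) : hamiltonian m n ζ ψ = 0 ↔ MoveInvariant ζ ψ := by
  refine ⟨fun h => moveInvariant_of_terms_eq_zero (terms_eq_zero_of_hamiltonian_eq_zero h).1
    (terms_eq_zero_of_hamiltonian_eq_zero h).2, fun h => ?_⟩
  obtain ⟨h1, h2⟩ := terms_eq_zero_of_moveInvariant hζ h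
  simp [hamiltonian, LinearMap.sum_apply, h1, h2]

/-- The trimer state with the amplitudes in each winding sector multiplied by `g`. -/
def sectorState (m n : ℕ) [NeZero m] [NeZero n] (ζ : ℂ) :
    (ZMod 3 × ZMod 3 → ℂ) →ₗ[ℂ] HilbertSpace m n where
  toFun g := WithLp.toLp 2 fun c => g (windingH c, windingV c) * trimerState m n ζ c
  map_add' g g' := by ext c; simp [add_mul]
  map_smul' a g := by ext c; simp [mul_assoc]

theorem sectorState_apply [NeZero m] [NeZero n] (ζ : ℂ) (g : ZMod 3 × ZMod 3 → ℂ)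
    (c : Config m n) :
    sectorState m n ζ g c = g (windingH c, windingV c) * trimerState m n ζ c := rfl

theorem trimerState_of_valid [NeZero m] [NeZero n] (ζ : ℂ) {c : Config m n} (hc : Valid c) :
    trimerState m n ζ c = ζ ^ foldedCount c := if_pos hc

theorem trimerState_of_not_valid [NeZero m] [NeZero n] (ζ : ℂ) {c : Config m n}
    (hc : ¬ Valid c) : trimerState m n ζ c = 0 := if_neg hc

/-- Every winding sector contains a valid configuration, where the amplitude reveals `g`. -/
theorem injective_sectorState [NeZero m] [NeZero n] (hm : 3 ≤ m) {ζ : ℂ} (hζ : ζ ≠ 0) :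
    Function.Injective (sectorState m n ζ) := by
  intro g g' h
  ext ⟨a, b⟩
  obtain ⟨c, hc, rfl, rfl⟩ := exists_valid_winding_eq (n := n) hm a b
  have h1 : sectorState m n ζ g c = sectorState m n ζ g' c := by rw [h]
  rw [sectorState_apply, sectorState_apply, trimerState_of_valid ζ hc] at h1
  exact mul_right_cancel₀ (pow_ne_zero _ hζ) h1

theorem MoveInvariant.eq_of_reachable [NeZero m] [NeZero n] {ζ : ℂ} (hζ : ζ ≠ 0)
    {ψ : HilbertSpace m n} (h : MoveInvariant ζ ψ) {c c' : Config m n}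
    (hcc' : Relation.ReflTransGen TwoHexagonMove c c') :
    ψ c / ζ ^ foldedCount c = ψ c' / ζ ^ foldedCount c' := by
  induction hcc' with
  | refl => rfl
  | tail _ hmove ih =>
    rw [ih, div_eq_div_iff (pow_ne_zero _ hζ) (pow_ne_zero _ hζ)]
    exact h.2 _ _ hmove

theorem mem_range_sectorState_iff [NeZero m] [NeZero n] (hm : 3 ≤ m) (hn : 3 ≤ n) {ζ : ℂ}
    (hζ : ζ ≠ 0) (ψ : HilbertSpace m n) :
    ψ ∈ LinearMap.range (sectorState m n ζ) ↔ MoveInvariant ζ ψ := by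
  constructor
  · rintro ⟨g, rfl⟩
    refine ⟨fun c hc => by rw [sectorState_apply, trimerState_of_not_valid ζ hc, mul_zero],
      fun c c' hmove => ?_⟩
    rw [sectorState_apply, sectorState_apply, trimerState_of_valid ζ hmove.1,
      trimerState_of_valid ζ hmove.2.1, hmove.windingH_eq hn, hmove.windingV_eq hm]
    ring
  · intro h
    choose r hr using fun N : ZMod 3 × ZMod 3 =>
      exists_valid_winding_eq (m := m) (n := n) hm N.1 N.2
    refine ⟨fun N => ψ (r N) / ζ ^ foldedCount (r N), ?_⟩
    ext c
    rw [sectorState_apply]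
    by_cases hc : Valid c
    · obtain ⟨h1, h2, h3⟩ := hr (windingH c, windingV c)
      rw [h.eq_of_reachable hζ ((reachable_iff_winding_eq hm hn h1 hc).mpr ⟨h2, h3⟩),
        trimerState_of_valid ζ hc, div_mul_cancel₀ _ (pow_ne_zero _ hζ)]
    · rw [trimerState_of_not_valid ζ hc, mul_zero, h.1 c hc]

theorem isPrimitiveRoot_cubicOmega : IsPrimitiveRoot cubicOmega 3 := by
  have := Complex.isPrimitiveRoot_exp 3 three_ne_zero
  rwa [Nat.cast_ofNat] at this

/-- The additive character of `ℤ/3 × ℤ/3` that gives the phases of a sibling state. -/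
def siblingChar (ν : ZMod 3 × ZMod 3) : AddChar (ZMod 3 × ZMod 3) ℂ :=
  (AddChar.zmodChar 3 isPrimitiveRoot_cubicOmega.pow_eq_one).compAddMonoidHom
    ((AddMonoidHom.mulLeft ν.1).coprod (AddMonoidHom.mulLeft ν.2))

theorem siblingChar_apply (ν N : ZMod 3 × ZMod 3) :
    siblingChar ν N = cubicOmega ^ (ν.1 * N.1 + ν.2 * N.2).val := rfl

theorem injective_siblingChar : Function.Injective siblingChar := by
  intro ν ν' h
  have key : ∀ N : ZMod 3 × ZMod 3, ν.1 * N.1 + ν.2 * N.2 = ν'.1 * N.1 + ν'.2 * N.2 := fun N => by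
    have h1 : siblingChar ν N = siblingChar ν' N := by rw [h]
    rw [siblingChar_apply, siblingChar_apply] at h1
    exact ZMod.val_injective 3
      (isPrimitiveRoot_cubicOmega.pow_inj (ZMod.val_lt _) (ZMod.val_lt _) h1)
  ext
  · simpa using key (1, 0)
  · simpa using key (0, 1)

theorem span_siblingChar :
    Submodule.span ℂ (Set.range fun ν N => siblingChar ν N) = ⊤ := by
  have hli : LinearIndependent ℂ fun ν : ZMod 3 × ZMod 3 => (siblingChar ν : _ → ℂ) :=
    (AddChar.linearIndependent (ZMod 3 × ZMod 3) ℂ).comp siblingChar injective_siblingChar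
  exact hli.span_eq_top_of_card_eq_finrank' (by rw [Module.finrank_fintype_fun_eq_card])

theorem span_siblingState [NeZero m] [NeZero n] (ζ : ℂ) :
    Submodule.span ℂ (Set.range fun ν : ZMod 3 × ZMod 3 => siblingState m n ζ ν.1 ν.2) =
      LinearMap.range (sectorState m n ζ) := by
  rw [LinearMap.range_eq_map, ← span_siblingChar, Submodule.map_span, ← Set.range_comp]
  rfl

theorem isLeast_zero_eigenvalue [NeZero m] [NeZero n] (hm : 3 ≤ m) (hn : 3 ≤ n) {ζ : ℂ}
    (hζ : ζ ≠ 0) : IsLeast {E : ℝ | (hamiltonian m n ζ).HasEigenvalue (E : ℂ)} 0 := by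
  constructor
  · have hne : sectorState m n ζ 1 ≠ 0 := fun h => by
      have := injective_sectorState (n := n) hm hζ (h.trans (map_zero _).symm)
      exact one_ne_zero this
    refine Module.End.hasEigenvalue_of_hasEigenvector (x := sectorState m n ζ 1) ⟨?_, hne⟩
    rw [Module.End.mem_eigenspace_iff, Complex.ofReal_zero, zero_smul, hamiltonian_eq_zero_iff hζ,
      ← mem_range_sectorState_iff hm hn hζ]
    exact ⟨1, rfl⟩
  · intro E hE
    obtain ⟨ψ, hψ⟩ := hE.exists_hasEigenvector
    have h1 := (isPositive_hamiltonian ζ).re_inner_nonneg_right ψ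
    rw [hψ.apply_eq_smul, inner_smul_right] at h1
    have h2 : 0 < ‖ψ‖ ^ 2 := by
      have := norm_pos_iff.mpr hψ.2
      positivity
    have h3 : 0 ≤ ((E : ℂ) * inner ℂ ψ ψ).re := h1
    rw [Complex.re_ofReal_mul, show (inner ℂ ψ ψ).re = ‖ψ‖ ^ 2 from
      inner_self_eq_norm_sq (𝕜 := ℂ) ψ] at h3
    exact nonneg_of_mul_nonneg_left h3 h2

theorem mem_groundSpace_iff [NeZero m] [NeZero n] (hm : 3 ≤ m) (hn : 3 ≤ n) {ζ : ℂ}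
    (hζ : ζ ≠ 0) (ψ : HilbertSpace m n) :
    ψ ∈ groundSpace (hamiltonian m n ζ) ↔ hamiltonian m n ζ ψ = 0 := by
  rw [groundSpace, groundEnergy, (isLeast_zero_eigenvalue hm hn hζ).csInf_eq,
    Module.End.mem_eigenspace_iff, Complex.ofReal_zero, zero_smul]

theorem groundSpace_eq_range [NeZero m] [NeZero n] (hm : 3 ≤ m) (hn : 3 ≤ n) {ζ : ℂ}
    (hζ : ζ ≠ 0) :
    groundSpace (hamiltonian m n ζ) = LinearMap.range (sectorState m n ζ) := by
  ext ψ
  rw [mem_groundSpace_iff hm hn hζ, hamiltonian_eq_zero_iff hζ,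
    mem_range_sectorState_iff hm hn hζ]

end TrimerModel

end

open TrimerModel
theorem mainTheorem3 (m n : ℕ) [NeZero m] [NeZero n] (hm : 3 ≤ m) (hn : 3 ≤ n)
    (ζ : ℂ) (hζ : ζ ≠ 0) :
    -- a vertex term acts on 3 edges, a two-hexagon term on 11 edges
    (∀ v : Vertex m n, (vertexStar v).card = 3) ∧
    (∀ (p : Site m n) (d : Fin 3), (twoHexagon p d).card = 11) ∧
    -- all terms are positive semidefinite and the ground energy is zero
    (∀ v : Vertex m n, (vertexTerm v).IsPositive) ∧
    (∀ (p : Site m n) (d : Fin 3), (twoHexagonTerm ζ p d).IsPositive) ∧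
    (hamiltonian m n ζ).IsPositive ∧
    IsLeast {E : ℝ | (hamiltonian m n ζ).HasEigenvalue (E : ℂ)} 0 ∧
    -- frustration-freeness: ground states have zero energy for every single term
    (∀ ψ ∈ groundSpace (hamiltonian m n ζ),
      (∀ v : Vertex m n, vertexTerm v ψ = 0) ∧
      (∀ (p : Site m n) (d : Fin 3), twoHexagonTerm ζ p d ψ = 0)) ∧
    -- the ground space is 9-fold degenerate, spanned by the trimer state and its siblings
    Module.finrank ℂ (groundSpace (hamiltonian m n ζ)) = 9 ∧
    groundSpace (hamiltonian m n ζ) =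
      Submodule.span ℂ (Set.range fun ν : ZMod 3 × ZMod 3 => siblingState m n ζ ν.1 ν.2) ∧
    -- two-hexagon moves connect exactly the valid configurations in the same winding sector
    (∀ c c' : Config m n, Valid c → Valid c' →
      (Relation.ReflTransGen TwoHexagonMove c c' ↔
        windingH c = windingH c' ∧ windingV c = windingV c')) := by
  have hgs := groundSpace_eq_range hm hn hζ
  refine ⟨card_vertexStar, card_twoHexagon hm hn,
    fun v => (isSymmetricProjection_vertexTerm v).isPositive,
    fun p d => (isSymmetricProjection_twoHexagonTerm ζ p d).isPositive,
    isPositive_hamiltonian ζ, isLeast_zero_eigenvalue hm hn hζ, fun ψ hψ =>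
      terms_eq_zero_of_hamiltonian_eq_zero ((mem_groundSpace_iff hm hn hζ ψ).mp hψ), ?_, ?_,
    fun c c' hc hc' => reachable_iff_winding_eq hm hn hc hc'⟩
  · rw [hgs, LinearMap.finrank_range_of_inj (injective_sectorState hm hζ)]
    simp
  · rw [hgs, span_siblingState]
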